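/- Let $\{c_n\}_{n\ge 1}$ be a real sequence and let $\{d_{n+1}\}_{n\ge 1}$ be a positive chain sequence, i.e. there is a parameter sequence $\{g_n\}_{n\ge1}$ with $0\le g_1<1$, $0<g_n<1$ for $n\ge 2$, and $(1-g_n)g_{n+1}=d_{n+1}$ for $n\ge1$. Let $\{\ell_n\}_{n\ge1}$ be its minimal parameter sequence (the one with $\ell_1=0$). Let $P_0=1$, $P_1(x)=x-c_1$ and $$P_{n+1}(x)=(x-c_{n+1})P_n(x)-d_{n+1}(x^2+1)P_{n-1}(x),\qquad n\ge1,$$ and let $\tau_0=1$, $\tau_n=\tau_{n-1}\dfrac{1-ic_n}{1+ic_n}$ for $n\ge 1$. There is exactly one sequence of polynomials $\{\Phi_n\}_{n\ge0}\subset\mathbb C[z]$ such that, for all real $x$ and all $k\ge1$, with $\zeta=\frac{x+i}{x-i}$, $$\Phi_{k-1}(\zeta)=\frac{-i\,2^{k-1}}{\prod_{j=1}^{k}(1+ic_j)}\,\frac{1}{(x-i)^{k-1}}\bigl[P_k(x)-(1-\ell_k)(x-i)P_{k-1}(x)\bigr].$$ There is exactly one Borel probability measure $\mu$ on the unit circle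 $\mathbb T$ that is nontrivial (not carried by a finite set) and has the Verblunsky coefficients $$\alpha_{n-1}=-\frac1{\tau_n}\,\frac{1-2\ell_{n+1}-ic_{n+1}}{1-ic_{n+1}},\qquad n\ge1,$$ where the Verblunsky coefficients of a nontrivial measure are $\alpha_{n-1}=-\overline{\Psi_n(0)}$, with $\{\Psi_n\}_{n\ge0}$ its monic orthogonal polynomials. The polynomials $\Phi_n$ are the monic orthogonal polynomials of $\mu$: $\Phi_n$ is monic of degree $n$, and for all $m,k\ge0$ $$\int_{\mathbb T}\overline{\Phi_m(\zeta)}\,\Phi_k(\zeta)\,d\mu(\zeta)=\frac{(1+c_1^2)\,2^{2k}\prod_{j=1}^{k+1}d_{j+1}}{\ell_{k+2}\prod_{j=1}^{k+1}(1+c_j^2)}\,\delta_{m,k}.$$ Moreover, if $\{d_{n+1}\}_{n\ge1}$ has more than one parameter sequence, then $\int_{\mathbb T}|\zeta-1|^{-2}\,d\mu(\zeta)<\infty$ (where $|\zeta-1|^{-2}=+\infty$ at $\zeta=1$). -/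

import Mathlib

open MeasureTheory Polynomial

noncomputable section

/-- `g = (g 1, g 2, …)` is a parameter sequence of `d = (d 2, d 3, …)`:
`0 ≤ g 1 < 1`, `0 < g n < 1` for `n ≥ 2`, and `(1 - g n) * g (n + 1) = d (n + 1)` for `n ≥ 1`.
(The values `g 0`, `d 0`, `d 1` play no role.) -/
def IsParameterSequence (d g : ℕ → ℝ) : Prop :=
  (0 ≤ g 1 ∧ g 1 < 1) ∧ (∀ n, 2 ≤ n → 0 < g n ∧ g n < 1) ∧
    ∀ n, 1 ≤ n → (1 - g n) * g (n + 1) = d (n + 1)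

/-- `d = (d 2, d 3, …)` is a positive chain sequence: it has a parameter sequence. -/
def IsPositiveChainSequence (d : ℕ → ℝ) : Prop :=
  ∃ g, IsParameterSequence d g

/-- `d = (d 2, d 3, …)` has more than one parameter sequence. -/
def HasMultipleParameterSequences (d : ℕ → ℝ) : Prop :=
  ∃ g h, IsParameterSequence d g ∧ IsParameterSequence d h ∧ ∃ n, 1 ≤ n ∧ g n ≠ h n

/-- The minimal parameter sequence `ℓ` of `d`: `ℓ 1 = 0` and `(1 - ℓ n) * ℓ (n + 1) = d (n + 1)`
for `n ≥ 1`. See `minParam_isParameterSequence` and `minParam_le`. -/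
def minParam (d : ℕ → ℝ) : ℕ → ℝ
  | 0 => 0
  | 1 => 0
  | n + 2 => d (n + 2) / (1 - minParam d (n + 1))

theorem minParam_bounds {d g : ℕ → ℝ} (hg : IsParameterSequence d g) (n : ℕ) :
    0 ≤ minParam d (n + 1) ∧ minParam d (n + 1) ≤ g (n + 1) ∧ g (n + 1) < 1 := by
  obtain ⟨h1, h2, h3⟩ := hg
  induction n with
  | zero => exact ⟨le_rfl, h1.1, h1.2⟩
  | succ n ih =>
    obtain ⟨i1, i2, i3⟩ := ih
    have e := h3 (n + 1) (by omega)
    have b := h2 (n + 1 + 1) (by omega)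
    have hp : 0 < 1 - minParam d (n + 1) := by linarith
    have hm : minParam d (n + 1 + 1) = d (n + 1 + 1) / (1 - minParam d (n + 1)) := rfl
    rw [hm, ← e]
    refine ⟨div_nonneg (mul_nonneg (by linarith) b.1.le) hp.le, ?_, b.2⟩
    rw [div_le_iff₀ hp, mul_comm]
    exact mul_le_mul_of_nonneg_left (by linarith) b.1.le

/-- The minimal parameter sequence of a positive chain sequence is a parameter sequence. -/
theorem minParam_isParameterSequence {d : ℕ → ℝ} (hd : IsPositiveChainSequence d) :
    IsParameterSequence d (minParam d) := by
  obtain ⟨g, hg⟩ := hd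
  have hb := minParam_bounds hg
  obtain ⟨h1, h2, h3⟩ := hg
  have hp : ∀ n, 0 < 1 - minParam d (n + 1) := fun n => by
    have := hb n
    linarith
  refine ⟨⟨le_rfl, zero_lt_one⟩, ?_, ?_⟩
  · intro n hn
    obtain ⟨k, rfl⟩ := Nat.exists_eq_add_of_le' hn
    refine ⟨?_, ?_⟩
    · have e := h3 (k + 1) (by omega)
      have hd' : 0 < d (k + 2) := by
        rw [← e]
        exact mul_pos (by linarith [(hb k).2.2]) (h2 (k + 1 + 1) (by omega)).1
      exact div_pos hd' (hp k)
    · have := hb (k + 1)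
      exact lt_of_le_of_lt this.2.1 this.2.2
  · intro n hn
    obtain ⟨k, rfl⟩ := Nat.exists_eq_add_of_le' hn
    exact mul_div_cancel₀ _ (hp k).ne'

/-- It is pointwise the smallest one. -/
theorem minParam_le {d g : ℕ → ℝ} (hg : IsParameterSequence d g) {n : ℕ} (hn : 1 ≤ n) :
    minParam d n ≤ g n := by
  obtain ⟨k, rfl⟩ := Nat.exists_eq_add_of_le' hn
  exact (minParam_bounds hg k).2.1

/-- The polynomials of the recurrence `P 0 = 1`, `P 1 = x - c 1`,
`P (n + 1) = (x - c (n + 1)) * P n - d (n + 1) * (x ^ 2 + 1) * P (n - 1)` for `n ≥ 1`. -/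
def rTwoPoly (c d : ℕ → ℝ) : ℕ → ℝ[X]
  | 0 => 1
  | 1 => X - C (c 1)
  | n + 2 => (X - C (c (n + 2))) * rTwoPoly c d (n + 1)
      - C (d (n + 2)) * (X ^ 2 + 1) * rTwoPoly c d n

/-- `τ 0 = 1` and `τ n = τ (n - 1) * (1 - i * c n) / (1 + i * c n)` for `n ≥ 1`. -/
def tauSeq (c : ℕ → ℝ) : ℕ → ℂ
  | 0 => 1
  | n + 1 => tauSeq c n * ((1 - Complex.I * c (n + 1)) / (1 + Complex.I * c (n + 1)))

/-- `alphaSeq c d (n - 1) = -(1 / τ n) * (1 - 2 * ℓ (n + 1) - i * c (n + 1)) / (1 - i * c (n + 1))`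
for `n ≥ 1`; here `n - 1` is written `n`. -/
def alphaSeq (c d : ℕ → ℝ) (n : ℕ) : ℂ :=
  -(1 / tauSeq c (n + 1)) *
    ((1 - 2 * minParam d (n + 2) - Complex.I * c (n + 2)) / (1 - Complex.I * c (n + 2)))

/-- The polynomials `Φ 0, Φ 1, …` are given, in the variable `ζ = (x + i) / (x - i)`, `x` real, by
`Φ (k - 1) (ζ) = (-i * 2 ^ (k - 1) / ∏_{j = 1}^{k} (1 + i * c j)) * (1 / (x - i) ^ (k - 1)) *
  (P k (x) - (1 - ℓ k) * (x - i) * P (k - 1) (x))` for `k ≥ 1`; here `k - 1` is written `n`. -/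
def IsGivenByRTwo (c d : ℕ → ℝ) (Φ : ℕ → ℂ[X]) : Prop :=
  ∀ (n : ℕ) (x : ℝ),
    (Φ n).eval (((x : ℂ) + Complex.I) / ((x : ℂ) - Complex.I)) =
      (-Complex.I * 2 ^ n / ∏ j ∈ Finset.Icc 1 (n + 1), (1 + Complex.I * (c j : ℂ))) *
        (1 / ((x : ℂ) - Complex.I) ^ n) *
        (((rTwoPoly c d (n + 1)).eval x : ℝ)
          - (1 - (minParam d (n + 1) : ℂ)) * ((x : ℂ) - Complex.I)
            * ((rTwoPoly c d n).eval x : ℝ))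

/-- The unit circle carries its Borel σ-algebra. -/
instance instMeasurableSpaceCircle : MeasurableSpace Circle := borel Circle

instance instBorelSpaceCircle : BorelSpace Circle := ⟨rfl⟩

/-- `∫ conj (p ζ) * q ζ dμ(ζ)` over the unit circle. -/
def circleInner (μ : Measure Circle) (p q : ℂ[X]) : ℂ :=
  ∫ ζ : Circle, (starRingEnd ℂ) (p.eval (ζ : ℂ)) * q.eval (ζ : ℂ) ∂μ

/-- `Φ n` is monic of degree `n` for every `n`, and the `Φ n` are pairwise orthogonal
with respect to `μ`. -/
def IsMonicOPUC (μ : Measure Circle) (Φ : ℕ → ℂ[X]) : Prop :=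
  (∀ n, (Φ n).Monic ∧ (Φ n).natDegree = n) ∧ ∀ m n, m ≠ n → circleInner μ (Φ m) (Φ n) = 0

/-- `μ` is not carried by a finite set. -/
def IsNontrivialMeasure (μ : Measure Circle) : Prop :=
  ∀ s : Set Circle, s.Finite → μ sᶜ ≠ 0

/-- `α 0, α 1, …` are the Verblunsky coefficients `α n = - conj (Φ (n + 1) (0))` of the nontrivial
measure `μ`, where `Φ` is its sequence of monic orthogonal polynomials. -/
def HasVerblunskyCoefficients (μ : Measure Circle) (α : ℕ → ℂ) : Prop :=
  IsNontrivialMeasure μ ∧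
    ∃ Φ : ℕ → ℂ[X], IsMonicOPUC μ Φ ∧ ∀ n, α n = -(starRingEnd ℂ) ((Φ (n + 1)).eval 0)

end

/-! Each parameter sequence `g` turns the real recurrence into a Szegő recursion. With `ζ =
(x+i)/(x-i)`, the combinations `P (n+1) - (1 - g (n+1)) (x ∓ i) P n`, suitably scaled, are the monic
polynomial of degree `n+1` and its reversal for the coefficients `paramCoeff c g`
(`szego_paramCoeff_eval`). For the minimal sequence `ℓ 1 = 0`, so the initial coefficient is `1`;
every later polynomial is then `X - 1` times a polynomial of the recursion with coefficients
`alphaSeq` (`szego_succ_eq_X_sub_one_mul`). Dividing by `ζ - 1 = 2i/(x-i)` gives the stated formula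
for `Φ`.

The measure comes from Verblunsky's theorem. For coefficients in the open disc, the form declared
diagonal in the Szegő basis is positive and multiplication by `X` is isometric for it
(`szegoForm_X_mul`). Herglotz' theorem (`exists_circleInner_eq`) represents it by a probability
measure. Uniqueness holds because the coefficients determine the orthogonal polynomials
(`IsMonicOPUC.eq_szegoPoly`), and these determine the moments. The norms are products of `1 - |α
j|^2`, which telescope through the chain relation.

If there is a second parameter sequence, some `g` has `g 1 > 0`, so all of its coefficients lie in
the open disc and belong to a measure `ν`. Comparing the combinations for `g` and `ℓ` expresses
`(X-1)^2 Φ n` through the polynomials of `ν` (`X_sub_one_sq_mul_szegoPoly_alphaSeq`). This forces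
`μ` to be a multiple of `|ζ-1|^2 dν`, against which `|ζ-1|^(-2)` is integrable. -/

noncomputable section

/-! ### Polynomials generated by the Szegő recursion -/

/-- The pair `(Φ n, Φ n ^*)` generated from the coefficients `α` by the Szegő recursion. -/
def szegoPair (α : ℕ → ℂ) : ℕ → ℂ[X] × ℂ[X]
  | 0 => (1, 1)
  | n + 1 => (X * (szegoPair α n).1 - C ((starRingEnd ℂ) (α n)) * (szegoPair α n).2,
      (szegoPair α n).2 - C (α n) * (X * (szegoPair α n).1))

/-- The monic polynomials of the Szegő recursion. -/
def szegoPoly (α : ℕ → ℂ) (n : ℕ) : ℂ[X] := (szegoPair α n).1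

/-- The reversed polynomials of the Szegő recursion. -/
def szegoRev (α : ℕ → ℂ) (n : ℕ) : ℂ[X] := (szegoPair α n).2

/-- The product `∏ (1 - |α j| ^ 2)` over `j < n`. -/
def szegoNormSq (α : ℕ → ℂ) (n : ℕ) : ℝ := ∏ j ∈ Finset.range n, (1 - ‖α j‖ ^ 2)

section

variable (α : ℕ → ℂ)

@[simp] theorem szegoPoly_zero : szegoPoly α 0 = 1 := rfl

@[simp] theorem szegoRev_zero : szegoRev α 0 = 1 := rfl

theorem szegoPoly_succ (n : ℕ) : szegoPoly α (n + 1) =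
    X * szegoPoly α n - C ((starRingEnd ℂ) (α n)) * szegoRev α n := rfl

theorem szegoRev_succ (n : ℕ) : szegoRev α (n + 1) =
    szegoRev α n - C (α n) * (X * szegoPoly α n) := rfl

@[simp] theorem szegoNormSq_zero : szegoNormSq α 0 = 1 := rfl

theorem szegoNormSq_succ (n : ℕ) :
    szegoNormSq α (n + 1) = szegoNormSq α n * (1 - ‖α n‖ ^ 2) :=
  Finset.prod_range_succ _ _

variable {α} in
theorem szegoNormSq_pos (hα : ∀ n, ‖α n‖ < 1) (n : ℕ) : 0 < szegoNormSq α n :=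
  Finset.prod_pos fun j _ => by nlinarith [hα j, norm_nonneg (α j)]

theorem degree_szego (n : ℕ) :
    (szegoPoly α n).degree = n ∧ (szegoPoly α n).Monic ∧ (szegoRev α n).degree ≤ n := by
  induction n with
  | zero => simp
  | succ n ih =>
    obtain ⟨h1, h2, h3⟩ := ih
    have hX : (X * szegoPoly α n).degree = ((n + 1 : ℕ) : WithBot ℕ) := by
      rw [degree_mul, h1, degree_X, Nat.cast_add, add_comm]; rfl
    have hlt : (C ((starRingEnd ℂ) (α n)) * szegoRev α n).degree < (X * szegoPoly α n).degree := by
      rw [hX]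
      refine lt_of_le_of_lt ((smul_eq_C_mul (R := ℂ) _).symm ▸ degree_smul_le _ _) (lt_of_le_of_lt h3 ?_)
      exact_mod_cast Nat.lt_succ_self n
    refine ⟨?_, ?_, ?_⟩
    · rw [szegoPoly_succ, degree_sub_eq_left_of_degree_lt hlt, hX]
    · rw [szegoPoly_succ]
      exact (monic_X.mul h2).sub_of_left hlt
    · rw [szegoRev_succ]
      refine (degree_sub_le _ _).trans (max_le (h3.trans (by exact_mod_cast Nat.le_succ n)) ?_)
      exact ((smul_eq_C_mul (R := ℂ) _).symm ▸ degree_smul_le _ _).trans hX.le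

theorem szegoPoly_degree (n : ℕ) : (szegoPoly α n).degree = n := (degree_szego α n).1

theorem szegoPoly_monic (n : ℕ) : (szegoPoly α n).Monic := (degree_szego α n).2.1

theorem szegoPoly_natDegree (n : ℕ) : (szegoPoly α n).natDegree = n :=
  natDegree_eq_of_degree_eq_some (szegoPoly_degree α n)

theorem szegoRev_eval_zero (n : ℕ) : (szegoRev α n).eval 0 = 1 := by
  induction n with
  | zero => simp
  | succ n ih => simp [szegoRev_succ, ih]

theorem szegoPoly_succ_eval_zero (n : ℕ) :
    (szegoPoly α (n + 1)).eval 0 = -(starRingEnd ℂ) (α n) := by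
  simp [szegoPoly_succ, szegoRev_eval_zero]

/-- On the circle `conj z = 1/z`, so the two lines of the recursion are exchanged by conjugation
followed by multiplication with a power of `z`. -/
theorem szegoRev_eval_circle (n : ℕ) (z : Circle) :
    (szegoRev α n).eval (z : ℂ) = (z : ℂ) ^ n * (starRingEnd ℂ) ((szegoPoly α n).eval (z : ℂ)) := by
  have hz : (z : ℂ) * (starRingEnd ℂ) (z : ℂ) = 1 := by
    rw [Complex.mul_conj, Circle.normSq_coe, Complex.ofReal_one]
  induction n with
  | zero => simp
  | succ n ih =>
    have hzn : (z : ℂ) ^ n * (starRingEnd ℂ) (z : ℂ) ^ n = 1 := by rw [← mul_pow, hz, one_pow]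
    rw [szegoRev_succ, szegoPoly_succ]
    simp only [eval_sub, eval_mul, eval_C, eval_X, map_sub, map_mul, map_pow, Complex.conj_conj, ih]
    linear_combination (-(z : ℂ) ^ n * (starRingEnd ℂ) ((szegoPoly α n).eval (z : ℂ))) * hz
      + (α n * z * (szegoPoly α n).eval (z : ℂ)) * hzn

/-- `X Φ n` in terms of the next pair. -/
theorem X_mul_szegoPoly (n : ℕ) : X * szegoPoly α n =
    szegoPoly α (n + 1) + C ((starRingEnd ℂ) (α n)) * szegoRev α n := by
  rw [szegoPoly_succ]; ring

/-- Eliminates `X Φ n`, whose inner products are not known until multiplication by `X` is shown to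
be isometric. -/
theorem szegoRev_succ' (n : ℕ) : szegoRev α (n + 1) =
    C ((1 - ‖α n‖ ^ 2 : ℝ) : ℂ) * szegoRev α n - C (α n) * szegoPoly α (n + 1) := by
  have h : ((‖α n‖ ^ 2 : ℝ) : ℂ) = α n * (starRingEnd ℂ) (α n) := by
    rw [Complex.mul_conj, Complex.normSq_eq_norm_sq]
  rw [szegoRev_succ, szegoPoly_succ, Complex.ofReal_sub, h]
  simp only [map_sub, map_mul, Complex.ofReal_one, map_one]
  ring

/-- The basis of monic polynomials of the Szegő recursion. -/
def szegoBasis : Module.Basis ℕ ℂ ℂ[X] :=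
  Polynomial.Sequence.basis ⟨szegoPoly α, szegoPoly_degree α⟩ fun n => by
    show IsUnit (szegoPoly α n).leadingCoeff
    rw [szegoPoly_monic α n]; exact isUnit_one

@[simp] theorem szegoBasis_apply (n : ℕ) : szegoBasis α n = szegoPoly α n :=
  Polynomial.Sequence.basis_eq_self _ _ n

/-! ### The sesquilinear form that makes these polynomials orthogonal -/

/-- The form with `⟪Φ m, Φ n⟫ = δ_{m n} ∏_{j < n} (1 - |α j| ^ 2)`. -/
def szegoForm : ℂ[X] →ₗ⋆[ℂ] ℂ[X] →ₗ[ℂ] ℂ :=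
  LinearMap.mk₂'ₛₗ (starRingEnd ℂ) (RingHom.id ℂ)
    (fun p q => ((szegoBasis α).repr q).sum fun n a =>
      (szegoNormSq α n : ℂ) * (starRingEnd ℂ) ((szegoBasis α).repr p n) * a)
    (fun p p' q => by simp [mul_add, add_mul, Finsupp.sum_add])
    (fun a p q => by simp [Finsupp.mul_sum, mul_assoc, mul_left_comm])
    (fun p q q' => by
      simp only [map_add]
      exact Finsupp.sum_add_index' (by simp) (by intros; ring))
    (fun a p q => by
      simp only [map_smul, RingHom.id_apply, smul_eq_mul]
      rw [Finsupp.sum_smul_index (by simp), Finsupp.mul_sum]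
      simp only [mul_left_comm])

theorem szegoForm_apply (p q : ℂ[X]) : szegoForm α p q =
    ((szegoBasis α).repr q).sum fun n a =>
      (szegoNormSq α n : ℂ) * (starRingEnd ℂ) ((szegoBasis α).repr p n) * a := rfl

theorem szegoForm_szegoPoly (m n : ℕ) : szegoForm α (szegoPoly α m) (szegoPoly α n) =
    if m = n then (szegoNormSq α n : ℂ) else 0 := by
  rw [szegoForm_apply, ← szegoBasis_apply, ← szegoBasis_apply, Module.Basis.repr_self,
    Module.Basis.repr_self, Finsupp.sum_single_index (by simp), Finsupp.single_apply]
  split_ifs <;> simp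

theorem szegoForm_symm (p q : ℂ[X]) :
    szegoForm α p q = (starRingEnd ℂ) (szegoForm α q p) := by
  rw [szegoForm_apply, szegoForm_apply, Finsupp.sum, Finsupp.sum, map_sum]
  set f := (szegoBasis α).repr p
  set g := (szegoBasis α).repr q
  -- The defining sum runs over the support of the second argument only, so both sums are extended
  -- to the union of the supports.
  rw [Finset.sum_subset (Finset.subset_union_left : g.support ⊆ g.support ∪ f.support),
    Finset.sum_subset (Finset.subset_union_right : f.support ⊆ g.support ∪ f.support)]
  · refine Finset.sum_congr rfl fun n _ => ?_
    simp only [map_mul, Complex.conj_ofReal, Complex.conj_conj]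
    ring
  · intro n _ hn
    simp [Finsupp.notMem_support_iff.1 hn]
  · intro n _ hn
    simp [Finsupp.notMem_support_iff.1 hn]

variable {α} in
theorem szegoForm_self_pos (hα : ∀ n, ‖α n‖ < 1) {p : ℂ[X]} (hp : p ≠ 0) :
    ∃ r : ℝ, 0 < r ∧ szegoForm α p p = r := by
  set f := (szegoBasis α).repr p with hf
  have hf0 : f ≠ 0 := fun h => hp (by simpa [hf] using h)
  refine ⟨∑ n ∈ f.support, szegoNormSq α n * Complex.normSq (f n), ?_, ?_⟩
  · refine Finset.sum_pos (fun n hn => mul_pos (szegoNormSq_pos hα n) ?_)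
      (Finsupp.support_nonempty_iff.2 hf0)
    exact Complex.normSq_pos.2 (Finsupp.mem_support_iff.1 hn)
  · rw [szegoForm_apply, Finsupp.sum, Complex.ofReal_sum]
    refine Finset.sum_congr rfl fun n _ => ?_
    rw [Complex.ofReal_mul, Complex.normSq_eq_conj_mul_self, mul_assoc]

theorem szegoForm_C_mul_left (a : ℂ) (p q : ℂ[X]) :
    szegoForm α (C a * p) q = (starRingEnd ℂ) a * szegoForm α p q := by
  rw [← smul_eq_C_mul, map_smulₛₗ, LinearMap.smul_apply, smul_eq_mul]

theorem szegoForm_C_mul_right (a : ℂ) (p q : ℂ[X]) :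
    szegoForm α p (C a * q) = a * szegoForm α p q := by
  rw [← smul_eq_C_mul, map_smul, smul_eq_mul]

/-- The reversed polynomial of index `m` lies in the span of `Φ 0, …, Φ m`. -/
theorem szegoForm_szegoRev_szegoPoly {m n : ℕ} (h : m < n) :
    szegoForm α (szegoRev α m) (szegoPoly α n) = 0 := by
  induction m with
  | zero =>
    rw [szegoRev_zero, ← szegoPoly_zero α, szegoForm_szegoPoly, if_neg (by omega)]
  | succ m ih =>
    rw [szegoRev_succ', map_sub, LinearMap.sub_apply, szegoForm_C_mul_left, szegoForm_C_mul_left,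
      ih (by omega), szegoForm_szegoPoly, if_neg (by omega)]
    simp

theorem szegoForm_szegoPoly_szegoRev {m n : ℕ} (h : m + 1 ≤ n) :
    szegoForm α (szegoPoly α (m + 1)) (szegoRev α n) = -(α m) * szegoNormSq α n := by
  induction n, h using Nat.le_induction with
  | base =>
    rw [szegoRev_succ', map_sub, szegoForm_C_mul_right, szegoForm_C_mul_right, szegoForm_symm,
      szegoForm_szegoRev_szegoPoly α (Nat.lt_succ_self m), szegoForm_szegoPoly, if_pos rfl]
    simp
  | succ n hn ih =>
    rw [szegoRev_succ', map_sub, szegoForm_C_mul_right, szegoForm_C_mul_right, ih,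
      szegoForm_szegoPoly, if_neg (by omega), szegoNormSq_succ]
    push_cast; ring

theorem szegoForm_szegoRev_self (n : ℕ) :
    szegoForm α (szegoRev α n) (szegoRev α n) = szegoNormSq α n := by
  induction n with
  | zero => rw [szegoRev_zero, ← szegoPoly_zero α, szegoForm_szegoPoly, if_pos rfl]
  | succ n ih =>
    have h0 := szegoForm_szegoRev_szegoPoly α (Nat.lt_succ_self n)
    have h0' : szegoForm α (szegoPoly α (n + 1)) (szegoRev α n) = 0 := by
      rw [szegoForm_symm, h0, map_zero]
    have hn : ((‖α n‖ ^ 2 : ℝ) : ℂ) = α n * (starRingEnd ℂ) (α n) := by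
      rw [Complex.mul_conj, Complex.normSq_eq_norm_sq]
    rw [szegoRev_succ']
    simp only [map_sub, LinearMap.sub_apply, szegoForm_C_mul_left, szegoForm_C_mul_right,
      h0, h0', ih, szegoForm_szegoPoly, if_true, szegoNormSq_succ, Complex.conj_ofReal]
    simp only [Complex.ofReal_mul, Complex.ofReal_sub, Complex.ofReal_one, hn]
    ring

theorem szegoForm_szegoRev {m n : ℕ} (h : m ≤ n) :
    szegoForm α (szegoRev α m) (szegoRev α n) = szegoNormSq α n := by
  induction n, h using Nat.le_induction with
  | base => exact szegoForm_szegoRev_self α m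
  | succ n hn ih =>
    rw [szegoRev_succ', map_sub, szegoForm_C_mul_right, szegoForm_C_mul_right, ih,
      szegoForm_szegoRev_szegoPoly α (Nat.lt_succ_of_le hn), szegoNormSq_succ]
    push_cast; ring

/-- Write each `X Φ` as `Φ (·+1)` plus a multiple of the reversed polynomial. For `m = n` the norms
recombine as `(1 - |α|^2) + |α|^2 = 1`; for `m < n` the two surviving terms `∓ α m * conj (α n)`
times the norm cancel. -/
theorem szegoForm_X_mul_szegoPoly {m n : ℕ} (h : m ≤ n) :
    szegoForm α (X * szegoPoly α m) (X * szegoPoly α n) =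
      szegoForm α (szegoPoly α m) (szegoPoly α n) := by
  rw [X_mul_szegoPoly, X_mul_szegoPoly, szegoForm_szegoPoly]
  simp only [map_add, LinearMap.add_apply, szegoForm_C_mul_left, szegoForm_C_mul_right,
    Complex.conj_conj, szegoForm_szegoPoly, szegoForm_szegoRev α h,
    szegoForm_szegoRev_szegoPoly α (Nat.lt_succ_of_le h)]
  rcases h.eq_or_lt with rfl | h
  · have h0 : szegoForm α (szegoPoly α (m + 1)) (szegoRev α m) = 0 := by
      rw [szegoForm_symm, szegoForm_szegoRev_szegoPoly α (Nat.lt_succ_self m), map_zero]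
    have hn : ((‖α m‖ ^ 2 : ℝ) : ℂ) = α m * (starRingEnd ℂ) (α m) := by
      rw [Complex.mul_conj, Complex.normSq_eq_norm_sq]
    simp only [h0, if_true, szegoNormSq_succ, Complex.ofReal_mul, Complex.ofReal_sub,
      Complex.ofReal_one, hn]
    ring
  · rw [szegoForm_szegoPoly_szegoRev α h, if_neg (by omega), if_neg (by omega)]
    ring

/-- Multiplication by the variable is isometric. -/
theorem szegoForm_X_mul (p q : ℂ[X]) : szegoForm α (X * p) (X * q) = szegoForm α p q := by
  let F : ℂ[X] →ₗ⋆[ℂ] ℂ[X] →ₗ[ℂ] ℂ := LinearMap.mk₂'ₛₗ (starRingEnd ℂ) (RingHom.id ℂ)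
    (fun p q => szegoForm α (X * p) (X * q)) (by simp [mul_add]) (by simp) (by simp [mul_add])
    (by simp)
  have key : F = szegoForm α := by
    refine LinearMap.ext_basis (szegoBasis α) (szegoBasis α) fun m n => ?_
    simp only [szegoBasis_apply, F, LinearMap.mk₂'ₛₗ_apply]
    rcases le_total m n with h | h
    · exact szegoForm_X_mul_szegoPoly α h
    · rw [szegoForm_symm, szegoForm_X_mul_szegoPoly α h, ← szegoForm_symm]
  exact LinearMap.congr_fun₂ key p q

end

/-! ### Integrals of polynomials over the unit circle -/

theorem Continuous.integrable_circle {μ : Measure Circle} [IsFiniteMeasure μ] {f : Circle → ℂ}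
    (hf : Continuous f) : Integrable f μ :=
  hf.integrable_of_hasCompactSupport (HasCompactSupport.of_compactSpace f)

theorem continuous_circle_coe : Continuous fun z : Circle => (z : ℂ) := continuous_subtype_val

theorem continuous_eval_circle (p : ℂ[X]) : Continuous fun z : Circle => p.eval (z : ℂ) :=
  p.continuous.comp continuous_circle_coe

theorem continuous_conj_eval_circle (p : ℂ[X]) :
    Continuous fun z : Circle => (starRingEnd ℂ) (p.eval (z : ℂ)) :=
  Complex.continuous_conj.comp (continuous_eval_circle p)

theorem circle_mul_conj (z : Circle) : (z : ℂ) * (starRingEnd ℂ) (z : ℂ) = 1 := by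
  rw [Complex.mul_conj, Circle.normSq_coe, Complex.ofReal_one]

/-- `circleInner μ` as a sesquilinear map. -/
def circleForm (μ : Measure Circle) [IsFiniteMeasure μ] : ℂ[X] →ₗ⋆[ℂ] ℂ[X] →ₗ[ℂ] ℂ :=
  LinearMap.mk₂'ₛₗ (starRingEnd ℂ) (RingHom.id ℂ) (circleInner μ)
    (fun p p' q => by
      simp only [circleInner, eval_add, map_add, add_mul]
      exact integral_add
        ((continuous_conj_eval_circle p).mul (continuous_eval_circle q)).integrable_circle
        ((continuous_conj_eval_circle p').mul (continuous_eval_circle q)).integrable_circle)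
    (fun a p q => by
      simp only [circleInner, eval_smul, smul_eq_mul, map_mul, mul_assoc]
      exact integral_const_mul _ _)
    (fun p q q' => by
      simp only [circleInner, eval_add, mul_add]
      exact integral_add
        ((continuous_conj_eval_circle p).mul (continuous_eval_circle q)).integrable_circle
        ((continuous_conj_eval_circle p).mul (continuous_eval_circle q')).integrable_circle)
    (fun a p q => by
      simp only [circleInner, eval_smul, smul_eq_mul, mul_left_comm, RingHom.id_apply]
      exact integral_const_mul _ _)

section

variable {μ : Measure Circle} [IsFiniteMeasure μ]

@[simp] theorem circleForm_apply (p q : ℂ[X]) : circleForm μ p q = circleInner μ p q := rfl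

theorem circleInner_symm (μ : Measure Circle) (p q : ℂ[X]) :
    circleInner μ p q = (starRingEnd ℂ) (circleInner μ q p) := by
  rw [circleInner, circleInner, ← integral_conj]
  refine integral_congr_ae (Filter.Eventually.of_forall fun z => ?_)
  simp [mul_comm]

theorem circleInner_X_mul (μ : Measure Circle) (p q : ℂ[X]) :
    circleInner μ (X * p) (X * q) = circleInner μ p q := by
  refine integral_congr_ae (Filter.Eventually.of_forall fun z => ?_)
  simp only [eval_mul, eval_X, map_mul]
  linear_combination ((starRingEnd ℂ) (p.eval (z : ℂ)) * q.eval (z : ℂ)) * circle_mul_conj z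

theorem circleInner_X_pow_mul (μ : Measure Circle) (k : ℕ) (p q : ℂ[X]) :
    circleInner μ (X ^ k * p) (X ^ k * q) = circleInner μ p q := by
  induction k with
  | zero => simp
  | succ k ih => rw [pow_succ', mul_assoc, mul_assoc, circleInner_X_mul, ih]

theorem circleInner_one_one (μ : Measure Circle) [IsProbabilityMeasure μ] :
    circleInner μ 1 1 = 1 := by
  simp [circleInner]

theorem circleInner_self_eq_zero {p : ℂ[X]} (h : circleInner μ p p = 0) :
    ∀ᵐ z : Circle ∂μ, p.eval (z : ℂ) = 0 := by
  have e : circleInner μ p p = ((∫ z : Circle, Complex.normSq (p.eval (z : ℂ)) ∂μ : ℝ) : ℂ) := by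
    rw [circleInner, ← integral_complex_ofReal]
    simp only [Complex.normSq_eq_conj_mul_self]
  rw [e, Complex.ofReal_eq_zero, integral_eq_zero_iff_of_nonneg
    (fun z => Complex.normSq_nonneg _)] at h
  · filter_upwards [h] with z hz using Complex.normSq_eq_zero.1 hz
  · exact (Complex.continuous_normSq.comp
      (continuous_eval_circle p)).integrable_of_hasCompactSupport
      (HasCompactSupport.of_compactSpace _)

theorem IsNontrivialMeasure.eq_zero {μ : Measure Circle} (hμ : IsNontrivialMeasure μ) {p : ℂ[X]}
    (h : ∀ᵐ z : Circle ∂μ, p.eval (z : ℂ) = 0) : p = 0 := by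
  by_contra hp
  refine hμ {z : Circle | p.eval (z : ℂ) = 0} ?_ h
  exact ((p.rootSet_finite ℂ).preimage Circle.coe_injective.injOn).subset fun z hz => by
    have hz' : p.eval (z : ℂ) = 0 := hz
    simp [mem_rootSet, hp, hz']

theorem IsNontrivialMeasure.of_circleInner_ne_zero {μ : Measure Circle}
    (h : ∀ p : ℂ[X], p ≠ 0 → circleInner μ p p ≠ 0) : IsNontrivialMeasure μ := by
  intro s hs h0
  lift s to Finset Circle using hs
  -- A nonzero polynomial vanishing on the finite carrier would have norm zero.
  refine h (∏ a ∈ s, (X - C (a : ℂ))) (Finset.prod_ne_zero_iff.2 fun a _ => X_sub_C_ne_zero _) ?_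
  have hae : ∀ᵐ z ∂μ, z ∈ s := h0
  rw [circleInner, ← integral_zero Circle ℂ (μ := μ)]
  refine integral_congr_ae ?_
  filter_upwards [hae] with z hz
  rw [eval_prod, Finset.prod_eq_zero hz (by simp), mul_zero]

/-- A sesquilinear form for which multiplication by the variable is isometric is given by
integration against `μ` as soon as the moments agree. -/
theorem circleInner_eq_of_moments {B : ℂ[X] →ₗ⋆[ℂ] ℂ[X] →ₗ[ℂ] ℂ}
    (hsymm : ∀ p q, B p q = (starRingEnd ℂ) (B q p))
    (hX : ∀ p q, B (X * p) (X * q) = B p q)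
    (h : ∀ m : ℕ, circleInner μ 1 (X ^ m) = B 1 (X ^ m)) (p q : ℂ[X]) :
    circleInner μ p q = B p q := by
  have hX' : ∀ (k : ℕ) p q, B (X ^ k * p) (X ^ k * q) = B p q := fun k p q => by
    induction k with
    | zero => simp
    | succ k ih => rw [pow_succ', mul_assoc, mul_assoc, hX, ih]
  have aux : ∀ j k : ℕ, j ≤ k → circleInner μ (X ^ j) (X ^ k) = B (X ^ j) (X ^ k) := by
    intro j k hjk
    obtain ⟨m, rfl⟩ := Nat.exists_eq_add_of_le hjk
    have e1 := circleInner_X_pow_mul μ j 1 (X ^ m)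
    have e2 := hX' j 1 (X ^ m)
    rw [mul_one, ← pow_add] at e1 e2
    rw [e1, e2, h]
  have key : circleForm μ = B := by
    refine LinearMap.ext_basis (Polynomial.basisMonomials ℂ) (Polynomial.basisMonomials ℂ)
      fun j k => ?_
    simp only [coe_basisMonomials, ← X_pow_eq_monomial, circleForm_apply]
    rcases le_total j k with hjk | hjk
    · exact aux j k hjk
    · rw [circleInner_symm, aux k j hjk, ← hsymm]
  exact LinearMap.congr_fun₂ key p q

end

/-- Finite measures on the circle are determined by their moments. -/
theorem Measure.ext_of_circleInner {μ ν : Measure Circle} [IsFiniteMeasure μ] [IsFiniteMeasure ν]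
    (h : ∀ p q : ℂ[X], circleInner μ p q = circleInner ν p q) : μ = ν := by
  -- The trigonometric polynomials, written as `conj z ^ k * p z`. They separate points, and their
  -- integrals are the values `circleInner μ (X ^ k) p`.
  let A : StarSubalgebra ℂ (BoundedContinuousFunction Circle ℂ) :=
    { carrier := {f | ∃ (k : ℕ) (p : ℂ[X]), ∀ z : Circle,
        f z = (starRingEnd ℂ) (z : ℂ) ^ k * p.eval (z : ℂ)}
      mul_mem' := by
        rintro f g ⟨k, p, hf⟩ ⟨l, q, hg⟩
        refine ⟨k + l, p * q, fun z => ?_⟩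
        simp only [BoundedContinuousFunction.mul_apply, hf, hg, eval_mul]
        ring
      add_mem' := by
        rintro f g ⟨k, p, hf⟩ ⟨l, q, hg⟩
        refine ⟨k + l, X ^ l * p + X ^ k * q, fun z => ?_⟩
        have hk : ∀ n : ℕ, (starRingEnd ℂ) (z : ℂ) ^ n * (z : ℂ) ^ n = 1 := fun n => by
          rw [← mul_pow, mul_comm, circle_mul_conj, one_pow]
        simp only [BoundedContinuousFunction.add_apply, hf, hg, eval_mul, eval_add, eval_pow,
          eval_X, pow_add]
        linear_combination (-(starRingEnd ℂ) (z : ℂ) ^ k * p.eval (z : ℂ)) * hk l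
          + (-(starRingEnd ℂ) (z : ℂ) ^ l * q.eval (z : ℂ)) * hk k
      algebraMap_mem' := fun a => ⟨0, C a, fun z => by simp⟩
      star_mem' := by
        rintro f ⟨k, p, hf⟩
        -- Since `conj z` is the inverse of `z`, `conj (p z)` is `conj z ^ natDegree` times the
        -- reversal of the conjugated polynomial at `z`.
        refine ⟨p.natDegree, X ^ k * (p.map (starRingEnd ℂ)).reverse, fun z => ?_⟩
        let u : Invertible ((starRingEnd ℂ) (z : ℂ)) :=
          ⟨z, circle_mul_conj z, by rw [mul_comm, circle_mul_conj]⟩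
        have hr := eval₂_reverse_mul_pow (RingHom.id ℂ) ((starRingEnd ℂ) (z : ℂ))
          (p.map (starRingEnd ℂ))
        rw [show ⅟((starRingEnd ℂ) (z : ℂ)) = (z : ℂ) from rfl, eval₂_id, eval₂_id,
          eval_map_apply, natDegree_map] at hr
        rw [BoundedContinuousFunction.star_apply, hf, ← starRingEnd_apply, map_mul, map_pow,
          Complex.conj_conj, ← hr, eval_mul, eval_pow, eval_X]
        ring }
  refine ext_of_forall_mem_subalgebra_integral_eq_of_pseudoEMetric_complete_countable (𝕜 := ℂ)
    (A := A) ?_ ?_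
  · intro z w hzw
    let f : BoundedContinuousFunction Circle ℂ :=
      BoundedContinuousFunction.mkOfCompact ⟨fun z : Circle => (z : ℂ), continuous_circle_coe⟩
    refine ⟨fun z => (z : ℂ), ⟨f.toContinuousMap, ⟨f, ⟨0, X, fun z => ?_⟩, rfl⟩, rfl⟩, ?_⟩
    · simp [f]
    · exact fun e => hzw (Circle.coe_injective e)
  · rintro f ⟨k, p, hf⟩
    have := h (X ^ k) p
    simpa only [circleInner, hf, eval_pow, eval_X, map_pow] using this

/-! ### Herglotz' theorem -/

/-- Normalized arc length. -/
def circleHaar : Measure Circle := Measure.haarMeasure ⊤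

instance : IsProbabilityMeasure circleHaar :=
  ⟨Measure.haarMeasure_self (K₀ := (⊤ : TopologicalSpace.PositiveCompacts Circle))⟩

instance : circleHaar.IsMulLeftInvariant := by unfold circleHaar; infer_instance

/-- Rotation by a point `w` with `w ^ m = -1` preserves the measure and changes the sign of the
integrand. -/
theorem integral_zpow_circleHaar {m : ℤ} (hm : m ≠ 0) :
    ∫ z : Circle, (z : ℂ) ^ m ∂circleHaar = 0 := by
  let w : Circle := Circle.exp (Real.pi / m)
  have hw : (w : ℂ) ^ m = -1 := by
    rw [← Circle.coe_zpow, ← Circle.exp_intCast_mul, mul_div_cancel₀ _ (by exact_mod_cast hm),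
      Circle.coe_exp, Complex.exp_pi_mul_I]
  have := integral_mul_left_eq_self (μ := circleHaar) (fun z : Circle => (z : ℂ) ^ m) w
  simp only [Circle.coe_mul, mul_zpow, hw, neg_mul, one_mul, integral_neg] at this
  linear_combination (-1 / 2 : ℂ) * this

theorem circleInner_circleHaar (j k : ℕ) :
    circleInner circleHaar (X ^ j) (X ^ k) = if j = k then 1 else 0 := by
  have e : ∀ z : Circle, (starRingEnd ℂ) (z : ℂ) ^ j * (z : ℂ) ^ k = (z : ℂ) ^ ((k : ℤ) - j) := by
    intro z
    rw [zpow_sub₀ z.coe_ne_zero, zpow_natCast, zpow_natCast, ← Circle.coe_inv_eq_conj,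
      Circle.coe_inv, inv_pow, div_eq_mul_inv, mul_comm]
  simp only [circleInner, eval_pow, eval_X, map_pow, e]
  split_ifs with h
  · simp [h]
  · exact integral_zpow_circleHaar (by omega)

section

variable (B : ℂ[X] →ₗ⋆[ℂ] ℂ[X] →ₗ[ℂ] ℂ)

/-- The Cesàro means of the Fourier series with coefficients `B (X ^ j) (X ^ k)`. -/
def cesaroDensity (N : ℕ) (z : Circle) : ℂ :=
  (N + 1 : ℂ)⁻¹ * B (∑ j ∈ Finset.range (N + 1), C ((starRingEnd ℂ) (z : ℂ) ^ j) * X ^ j)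
    (∑ j ∈ Finset.range (N + 1), C ((starRingEnd ℂ) (z : ℂ) ^ j) * X ^ j)

theorem cesaroDensity_eq (N : ℕ) (z : Circle) : cesaroDensity B N z =
    (N + 1 : ℂ)⁻¹ * ∑ j ∈ Finset.range (N + 1), ∑ k ∈ Finset.range (N + 1),
      B (X ^ j) (X ^ k) * ((z : ℂ) ^ j * (starRingEnd ℂ) (z : ℂ) ^ k) := by
  rw [cesaroDensity]
  have h : ∀ j k : ℕ, B (C ((starRingEnd ℂ) (z : ℂ) ^ j) * X ^ j)
      (C ((starRingEnd ℂ) (z : ℂ) ^ k) * X ^ k) =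
      B (X ^ j) (X ^ k) * ((z : ℂ) ^ j * (starRingEnd ℂ) (z : ℂ) ^ k) := fun j k => by
    rw [← smul_eq_C_mul, ← smul_eq_C_mul, B.map_smulₛₗ, LinearMap.smul_apply, LinearMap.map_smul, map_pow,
      Complex.conj_conj, smul_eq_mul, smul_eq_mul]
    ring
  rw [map_sum B]
  simp only [LinearMap.sum_apply]
  refine congrArg _ (Finset.sum_congr rfl fun j _ => ?_)
  rw [map_sum (B _)]
  exact Finset.sum_congr rfl fun k _ => h j k

theorem continuous_cesaroDensity (N : ℕ) : Continuous (cesaroDensity B N) := by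
  simp only [funext (cesaroDensity_eq B N)]
  refine continuous_const.mul (continuous_finsetSum _ fun j _ => continuous_finsetSum _ fun k _ =>
    continuous_const.mul ((continuous_circle_coe.pow j).mul
      ((Complex.continuous_conj.comp continuous_circle_coe).pow k)))

variable {B}

/-- Only the index pairs with `k = m + j` survive integration. There are `N + 1 - m` of them, none
if `m > N` in agreement with truncated subtraction, and each contributes `B 1 (X ^ m)` by isometry.
-/
theorem integral_pow_mul_cesaroDensity (hX : ∀ p q, B (X * p) (X * q) = B p q) (N m : ℕ) :
    ∫ z : Circle, (z : ℂ) ^ m * cesaroDensity B N z ∂circleHaar =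
      (((N + 1 - m : ℕ) : ℂ) / (N + 1 : ℂ)) * B 1 (X ^ m) := by
  have hX' : ∀ (k : ℕ) p q, B (X ^ k * p) (X ^ k * q) = B p q := fun k p q => by
    induction k with
    | zero => simp
    | succ k ih => rw [pow_succ', mul_assoc, mul_assoc, hX, ih]
  have e : ∀ z : Circle, (z : ℂ) ^ m * cesaroDensity B N z =
      (N + 1 : ℂ)⁻¹ * ∑ j ∈ Finset.range (N + 1), ∑ k ∈ Finset.range (N + 1),
        B (X ^ j) (X ^ k) * ((starRingEnd ℂ) ((X ^ k : ℂ[X]).eval (z : ℂ)) *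
          (X ^ (m + j) : ℂ[X]).eval (z : ℂ)) := by
    intro z
    rw [cesaroDensity_eq]
    simp only [Finset.mul_sum, eval_pow, eval_X, map_pow]
    refine Finset.sum_congr rfl fun j _ => Finset.sum_congr rfl fun k _ => by ring
  have hint : ∀ j k : ℕ, Integrable (fun z : Circle => B (X ^ j) (X ^ k) *
      ((starRingEnd ℂ) ((X ^ k : ℂ[X]).eval (z : ℂ)) *
        (X ^ (m + j) : ℂ[X]).eval (z : ℂ))) circleHaar := fun j k =>
    (((continuous_conj_eval_circle _).mul (continuous_eval_circle _)).integrable_circle).const_mul _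
  simp only [e]
  rw [integral_const_mul, integral_finsetSum _ fun j _ => integrable_finsetSum _ fun k _ =>
    hint j k]
  have e2 : ∀ j ∈ Finset.range (N + 1), ∫ z : Circle, ∑ k ∈ Finset.range (N + 1),
      B (X ^ j) (X ^ k) * ((starRingEnd ℂ) ((X ^ k : ℂ[X]).eval (z : ℂ)) *
        (X ^ (m + j) : ℂ[X]).eval (z : ℂ)) ∂circleHaar =
      if j < N + 1 - m then B 1 (X ^ m) else 0 := by
    intro j _
    rw [integral_finsetSum _ fun k _ => hint j k]
    have e3 : ∀ k, ∫ z : Circle, B (X ^ j) (X ^ k) *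
        ((starRingEnd ℂ) ((X ^ k : ℂ[X]).eval (z : ℂ)) *
        (X ^ (m + j) : ℂ[X]).eval (z : ℂ)) ∂circleHaar =
        if k = m + j then B 1 (X ^ m) else 0 := by
      intro k
      rw [integral_const_mul]
      have := circleInner_circleHaar k (m + j)
      rw [circleInner] at this
      rw [this]
      split_ifs with h
      · have := hX' j 1 (X ^ m)
        rw [mul_one, ← pow_add, add_comm j m, ← h] at this
        rw [this, mul_one]
      · rw [mul_zero]
    simp only [e3, Finset.sum_ite_eq', Finset.mem_range]
    congr 1
    simp only [eq_iff_iff]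
    omega
  rw [Finset.sum_congr rfl e2, ← Finset.sum_filter, Finset.sum_const, nsmul_eq_mul]
  have hc : ((Finset.range (N + 1)).filter fun j => j < N + 1 - m) = Finset.range (N + 1 - m) := by
    ext j; simp only [Finset.mem_filter, Finset.mem_range]; omega
  rw [hc, Finset.card_range]
  ring

/-- Herglotz' theorem: a positive form for which multiplication by the variable is isometric
is given by a probability measure on the unit circle. -/
theorem exists_circleInner_eq (hsymm : ∀ p q, B p q = (starRingEnd ℂ) (B q p))
    (hX : ∀ p q, B (X * p) (X * q) = B p q) (hpos : ∀ p, 0 ≤ (B p p).re) (h1 : B 1 1 = 1) :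
    ∃ μ : Measure Circle, IsProbabilityMeasure μ ∧ ∀ p q, circleInner μ p q = B p q := by
  -- The Cesàro mean at `z` is a positive multiple of some `B p p`, hence real and nonnegative.
  have hre : ∀ N z, 0 ≤ (cesaroDensity B N z).re ∧
      (((cesaroDensity B N z).re : ℝ) : ℂ) = cesaroDensity B N z := by
    intro N z
    obtain ⟨r, hr⟩ : ∃ r : ℝ, (r : ℂ) = (N + 1 : ℂ)⁻¹ := ⟨(N + 1 : ℝ)⁻¹, by push_cast; rfl⟩
    have hr0 : 0 ≤ r := by
      have : r = (N + 1 : ℝ)⁻¹ := by apply Complex.ofReal_injective; rw [hr]; push_cast; rfl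
      rw [this]; positivity
    rw [cesaroDensity, ← hr]
    set p := ∑ j ∈ Finset.range (N + 1), C ((starRingEnd ℂ) (z : ℂ) ^ j) * X ^ j
    obtain ⟨s, hs⟩ := Complex.conj_eq_iff_real.1 (hsymm p p).symm
    have hp := hpos p
    rw [hs, Complex.ofReal_re] at hp
    rw [hs, ← Complex.ofReal_mul, Complex.ofReal_re]
    exact ⟨mul_nonneg hr0 hp, rfl⟩
  have hcont : ∀ N, Continuous fun z => (cesaroDensity B N z).re := fun N =>
    Complex.continuous_re.comp (continuous_cesaroDensity B N)
  let κ : ℕ → Measure Circle := fun N =>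
    circleHaar.withDensity fun z => ENNReal.ofReal (cesaroDensity B N z).re
  have hκ : ∀ N (f : Circle → ℂ), ∫ z, f z ∂(κ N) =
      ∫ z, f z * cesaroDensity B N z ∂circleHaar := by
    intro N f
    rw [integral_withDensity_eq_integral_toReal_smul (hcont N).measurable.ennreal_ofReal
      (Filter.Eventually.of_forall fun z => ENNReal.ofReal_lt_top)]
    refine integral_congr_ae (Filter.Eventually.of_forall fun z => ?_)
    simp only [ENNReal.toReal_ofReal (hre N z).1, Complex.real_smul, (hre N z).2]
    ring
  have hprob : ∀ N, IsProbabilityMeasure (κ N) := by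
    intro N
    have hm := integral_pow_mul_cesaroDensity hX N 0
    have hN : (N + 1 : ℂ) ≠ 0 := by exact_mod_cast Nat.succ_ne_zero N
    simp only [pow_zero, one_mul, h1, mul_one, Nat.sub_zero, Nat.cast_add, Nat.cast_one,
      div_self hN] at hm
    have hm' : ∫ z, (cesaroDensity B N z).re ∂circleHaar = 1 := by
      apply Complex.ofReal_injective
      rw [← integral_complex_ofReal, Complex.ofReal_one, ← hm]
      simp only [(hre N _).2]
    constructor
    rw [withDensity_apply _ MeasurableSet.univ, Measure.restrict_univ,
      ← ofReal_integral_eq_lintegral_ofReal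
        ((hcont N).integrable_of_hasCompactSupport (HasCompactSupport.of_compactSpace _))
        (Filter.Eventually.of_forall fun z => (hre N z).1), hm', ENNReal.ofReal_one]
  let κ' : ℕ → ProbabilityMeasure Circle := fun N => ⟨κ N, hprob N⟩
  -- Probability measures on the compact circle form a compact space; a limit along a nonprincipal
  -- ultrafilter replaces a convergent subsequence.
  let F : Ultrafilter ℕ := Filter.hyperfilter ℕ
  obtain ⟨μ, -, hμ⟩ := isCompact_univ.ultrafilter_le_nhds (F.map κ') (by simp)
  have hlim : Filter.Tendsto κ' F (nhds μ) := hμ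
  rw [ProbabilityMeasure.tendsto_iff_forall_integral_rclike_tendsto ℂ] at hlim
  refine ⟨μ, inferInstance, circleInner_eq_of_moments hsymm hX fun m => ?_⟩
  let f : BoundedContinuousFunction Circle ℂ :=
    BoundedContinuousFunction.mkOfCompact
      ⟨fun z : Circle => (z : ℂ) ^ m, continuous_circle_coe.pow m⟩
  have hf := hlim f
  have e : ∀ N, ∫ z, f z ∂(κ' N : Measure Circle) =
      (((N + 1 - m : ℕ) : ℂ) / (N + 1 : ℂ)) * B 1 (X ^ m) := fun N => by
    rw [← integral_pow_mul_cesaroDensity hX N m]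
    exact hκ N f
  simp only [e] at hf
  have ht : Filter.Tendsto (fun N : ℕ => (((N + 1 - m : ℕ) : ℂ) / (N + 1 : ℂ)) * B 1 (X ^ m))
      Filter.atTop (nhds (B 1 (X ^ m))) := by
    have h0 : Filter.Tendsto (fun N : ℕ => (1 - (m : ℂ) * (1 / ((N : ℂ) + 1))) * B 1 (X ^ m))
        Filter.atTop (nhds ((1 - (m : ℂ) * 0) * B 1 (X ^ m))) :=
      ((tendsto_one_div_add_atTop_nhds_zero_nat (𝕜 := ℂ)).const_mul _).const_sub _ |>.mul_const _
    rw [mul_zero, sub_zero, one_mul] at h0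
    refine h0.congr' ?_
    filter_upwards [Filter.eventually_ge_atTop m] with N hN
    have hN1 : (N + 1 : ℂ) ≠ 0 := by exact_mod_cast Nat.succ_ne_zero N
    rw [Nat.cast_sub (by omega)]
    push_cast
    field_simp
  have hF : (F : Filter ℕ) ≤ Filter.atTop := by
    rw [← Nat.cofinite_eq_atTop]; exact Filter.hyperfilter_le_cofinite
  have := tendsto_nhds_unique hf (ht.mono_left hF)
  rw [← this]
  simp [circleInner, f]

end

/-! ### Orthogonal polynomials on the unit circle -/

namespace IsMonicOPUC

variable {μ : Measure Circle} {Φ : ℕ → ℂ[X]}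

theorem degree_eq (h : IsMonicOPUC μ Φ) (n : ℕ) : (Φ n).degree = n := by
  rw [degree_eq_natDegree (h.1 n).1.ne_zero, (h.1 n).2]

theorem zero_eq_one (h : IsMonicOPUC μ Φ) : Φ 0 = 1 :=
  (h.1 0).1.natDegree_eq_zero.1 (h.1 0).2

/-- The sequence of polynomials, indexed by degree. -/
def sequence (h : IsMonicOPUC μ Φ) : Polynomial.Sequence ℂ := ⟨Φ, h.degree_eq⟩

theorem isUnit_leadingCoeff (h : IsMonicOPUC μ Φ) (n : ℕ) :
    IsUnit (h.sequence n).leadingCoeff := by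
  show IsUnit (Φ n).leadingCoeff
  rw [(h.1 n).1]; exact isUnit_one

theorem circleInner_eq_zero [IsFiniteMeasure μ] (h : IsMonicOPUC μ Φ) {n : ℕ} {p : ℂ[X]}
    (hp : p.degree < n) : circleInner μ p (Φ n) = 0 := by
  rw [← mem_degreeLT, ← h.sequence.span_degreeLT fun i _ => h.isUnit_leadingCoeff i] at hp
  rw [← circleForm_apply]
  induction hp using Submodule.span_induction with
  | mem p hp =>
    obtain ⟨i, hi, rfl⟩ := hp
    exact h.2 i n (ne_of_lt hi)
  | zero => simp
  | add p q _ _ hp hq => rw [map_add, LinearMap.add_apply, hp, hq, add_zero]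
  | smul a p _ hp => rw [map_smulₛₗ, LinearMap.smul_apply, hp, smul_zero]

/-- A probability measure is determined by its monic orthogonal polynomials. -/
theorem measure_unique {ν : Measure Circle} [IsProbabilityMeasure μ] [IsProbabilityMeasure ν]
    (hμ : IsMonicOPUC μ Φ) (hν : IsMonicOPUC ν Φ) : μ = ν := by
  -- Integration sends `Φ 0 = 1` to `1` and every other `Φ n` to `0`, for both measures.
  have key : circleForm μ 1 = circleForm ν 1 := by
    refine (hμ.sequence.basis hμ.isUnit_leadingCoeff).ext fun n => ?_
    rw [Polynomial.Sequence.basis_eq_self]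
    show circleInner μ 1 (Φ n) = circleInner ν 1 (Φ n)
    rcases Nat.eq_zero_or_pos n with rfl | hn
    · rw [hμ.zero_eq_one, circleInner_one_one, circleInner_one_one]
    · rw [← hμ.zero_eq_one, hμ.2 0 n hn.ne, hν.2 0 n hn.ne]
  exact Measure.ext_of_circleInner fun p q =>
    circleInner_eq_of_moments (B := circleForm ν) (circleInner_symm ν) (circleInner_X_mul ν)
      (fun m => LinearMap.congr_fun key (X ^ m)) p q

end IsMonicOPUC

/-- If `Φ n` is orthogonal to all polynomials of lower degree, then `(Φ n)^*` is orthogonal to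
`X, …, X ^ n`. -/
theorem circleInner_X_mul_szegoRev {μ : Measure Circle} [IsFiniteMeasure μ] {α : ℕ → ℂ} {n : ℕ}
    (h : ∀ p : ℂ[X], p.degree < n → circleInner μ p (szegoPoly α n) = 0) {p : ℂ[X]}
    (hp : p.degree < n) : circleInner μ (X * p) (szegoRev α n) = 0 := by
  have key : ∀ i < n, circleInner μ (X * X ^ i) (szegoRev α n) = 0 := by
    intro i hi
    -- On the circle, pairing `X ^ (i+1)` with the reversed polynomial is the conjugate of pairing
    -- `X ^ (n-(i+1))` with the polynomial itself.
    have hd : ((X : ℂ[X]) ^ (n - (i + 1))).degree < n := by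
      rw [degree_X_pow]; exact_mod_cast (by omega)
    rw [← map_zero (starRingEnd ℂ), ← h _ hd, circleInner, circleInner, ← integral_conj]
    refine integral_congr_ae (Filter.Eventually.of_forall fun z => ?_)
    have hz : (starRingEnd ℂ) (z : ℂ) ^ (i + 1) * (z : ℂ) ^ (i + 1) = 1 := by
      rw [← mul_pow, mul_comm, circle_mul_conj, one_pow]
    have hn : (z : ℂ) ^ n = (z : ℂ) ^ (n - (i + 1)) * (z : ℂ) ^ (i + 1) := by
      rw [← pow_add, Nat.sub_add_cancel hi]
    simp only [szegoRev_eval_circle, ← pow_succ', eval_pow, eval_X, map_pow, map_mul,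
      Complex.conj_conj, hn]
    linear_combination ((z : ℂ) ^ (n - (i + 1)) *
      (starRingEnd ℂ) ((szegoPoly α n).eval (z : ℂ))) * hz
  by_cases hp0 : p = 0
  · simp [hp0, circleInner]
  rw [p.as_sum_range' n ((natDegree_lt_iff_degree_lt hp0).2 hp), Finset.mul_sum,
    ← circleForm_apply, map_sum, LinearMap.sum_apply]
  refine Finset.sum_eq_zero fun i hi => ?_
  rw [← smul_X_eq_monomial, mul_smul_comm, map_smulₛₗ, LinearMap.smul_apply, circleForm_apply,
    key i (Finset.mem_range.1 hi), smul_zero]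

/-- Monic orthogonal polynomials of a nontrivial measure satisfy the Szegő recursion. -/
theorem IsMonicOPUC.eq_szegoPoly {μ : Measure Circle} [IsFiniteMeasure μ] {Ψ : ℕ → ℂ[X]}
    {α : ℕ → ℂ} (hμ : IsNontrivialMeasure μ) (hΨ : IsMonicOPUC μ Ψ)
    (hα : ∀ n, α n = -(starRingEnd ℂ) ((Ψ (n + 1)).eval 0)) : Ψ = szegoPoly α := by
  funext n
  induction n with
  | zero => rw [hΨ.zero_eq_one, szegoPoly_zero]
  | succ n ih =>
    have horth : ∀ p : ℂ[X], p.degree < n → circleInner μ p (szegoPoly α n) = 0 := fun p hp => by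
      rw [← ih]; exact hΨ.circleInner_eq_zero hp
    have hX : (X * szegoPoly α n).degree = ((n + 1 : ℕ) : WithBot ℕ) := by
      rw [degree_mul, szegoPoly_degree, degree_X, Nat.cast_add, add_comm]; rfl
    -- `F` has degree at most `n` and vanishes at `0`, so `F = X * G`. It is therefore orthogonal to
    -- `Ψ (n+1)`, to `X Φ n` and to the reversed polynomial. As `F` is a combination of these three,
    -- its norm is zero.
    set F := Ψ (n + 1) - szegoPoly α (n + 1) with hF
    have hF' : F = Ψ (n + 1) - X * szegoPoly α n
        + C ((starRingEnd ℂ) (α n)) * szegoRev α n := by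
      rw [hF, szegoPoly_succ]; ring
    have hdeg : F.degree < ((n + 1 : ℕ) : WithBot ℕ) := by
      rw [hF, ← hΨ.degree_eq (n + 1)]
      refine degree_sub_lt_left ?_ (hΨ.1 _).1.ne_zero ?_
      · rw [hΨ.degree_eq, szegoPoly_degree]
      · rw [(hΨ.1 _).1, szegoPoly_monic]
    have h0 : F.coeff 0 = 0 := by
      rw [coeff_zero_eq_eval_zero, hF, eval_sub, szegoPoly_succ_eval_zero, hα]
      simp
    obtain ⟨G, hG⟩ := X_dvd_iff.2 h0
    have hGdeg : G.degree < n := by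
      by_cases hG0 : G = 0
      · rw [hG0, degree_zero]; exact WithBot.bot_lt_coe n
      · rw [hG, degree_mul, degree_X, degree_eq_natDegree hG0] at hdeg
        rw [degree_eq_natDegree hG0]
        norm_cast at hdeg ⊢
        omega
    have hFF : circleInner μ F F = 0 := by
      have e1 : circleInner μ F (Ψ (n + 1)) = 0 := hΨ.circleInner_eq_zero hdeg
      have e2 : circleInner μ F (X * szegoPoly α n) = 0 := by
        rw [hG, circleInner_X_mul]; exact horth G hGdeg
      have e3 : circleInner μ F (szegoRev α n) = 0 := by
        rw [hG]; exact circleInner_X_mul_szegoRev horth hGdeg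
      rw [← circleForm_apply] at e1 e2 e3 ⊢
      rw [show circleForm μ F F = circleForm μ F (Ψ (n + 1) - X * szegoPoly α n
        + C ((starRingEnd ℂ) (α n)) * szegoRev α n) from congrArg _ hF', map_add, map_sub, e1, e2, ← smul_eq_C_mul, map_smul, e3]
      simp
    exact sub_eq_zero.1 (hμ.eq_zero (circleInner_self_eq_zero hFF))

/-! ### Verblunsky's theorem -/

theorem exists_circleInner_eq_szegoForm {α : ℕ → ℂ} (hα : ∀ n, ‖α n‖ < 1) :
    ∃ μ : Measure Circle, IsProbabilityMeasure μ ∧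
      ∀ p q, circleInner μ p q = szegoForm α p q := by
  refine exists_circleInner_eq (szegoForm_symm α) (szegoForm_X_mul α) (fun p => ?_) ?_
  · by_cases hp : p = 0
    · simp [hp]
    · obtain ⟨r, hr, h⟩ := szegoForm_self_pos hα hp
      rw [h, Complex.ofReal_re]; exact hr.le
  · rw [← szegoPoly_zero α, szegoForm_szegoPoly, if_pos rfl, szegoNormSq_zero, Complex.ofReal_one]

section

variable {α : ℕ → ℂ} {μ : Measure Circle}

theorem isMonicOPUC_szegoPoly (h : ∀ p q, circleInner μ p q = szegoForm α p q) :
    IsMonicOPUC μ (szegoPoly α) :=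
  ⟨fun n => ⟨szegoPoly_monic α n, szegoPoly_natDegree α n⟩, fun m n hmn => by
    rw [h, szegoForm_szegoPoly, if_neg hmn]⟩

theorem isNontrivialMeasure_of_szegoForm (hα : ∀ n, ‖α n‖ < 1)
    (h : ∀ p q, circleInner μ p q = szegoForm α p q) : IsNontrivialMeasure μ :=
  .of_circleInner_ne_zero fun p hp => by
    obtain ⟨r, hr, e⟩ := szegoForm_self_pos hα hp
    rw [h, e]; exact_mod_cast hr.ne'

theorem hasVerblunskyCoefficients_of_szegoForm (hα : ∀ n, ‖α n‖ < 1)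
    (h : ∀ p q, circleInner μ p q = szegoForm α p q) : HasVerblunskyCoefficients μ α :=
  ⟨isNontrivialMeasure_of_szegoForm hα h, szegoPoly α, isMonicOPUC_szegoPoly h, fun n => by
    rw [szegoPoly_succ_eval_zero]; simp⟩

theorem HasVerblunskyCoefficients.isMonicOPUC [IsFiniteMeasure μ]
    (h : HasVerblunskyCoefficients μ α) : IsMonicOPUC μ (szegoPoly α) := by
  obtain ⟨hμ, Ψ, hΨ, hα⟩ := h
  rw [← hΨ.eq_szegoPoly hμ hα]; exact hΨ

/-- By uniqueness the given measure is the one built from the form, so its norms can be read off the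
form. -/
theorem HasVerblunskyCoefficients.circleInner_eq [IsProbabilityMeasure μ] (hα : ∀ n, ‖α n‖ < 1)
    (h : HasVerblunskyCoefficients μ α) (p q : ℂ[X]) :
    circleInner μ p q = szegoForm α p q := by
  obtain ⟨ν, hν, e⟩ := exists_circleInner_eq_szegoForm hα
  rw [h.isMonicOPUC.measure_unique (isMonicOPUC_szegoPoly e), e]

/-- Verblunsky's theorem. -/
theorem existsUnique_hasVerblunskyCoefficients (hα : ∀ n, ‖α n‖ < 1) :
    ∃! μ : Measure Circle, IsProbabilityMeasure μ ∧ HasVerblunskyCoefficients μ α := by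
  obtain ⟨ν, hν, e⟩ := exists_circleInner_eq_szegoForm hα
  refine ⟨ν, ⟨hν, hasVerblunskyCoefficients_of_szegoForm hα e⟩, ?_⟩
  rintro μ ⟨hμ, h⟩
  exact h.isMonicOPUC.measure_unique (isMonicOPUC_szegoPoly e)

end

/-! ### The Christoffel transform at the point `1` -/

/-- The probability measure proportional to `|ζ - 1| ^ 2 dν(ζ)`. -/
def christoffelTransform (ν : Measure Circle) : Measure Circle :=
  (∫⁻ ζ : Circle, ‖(ζ : ℂ) - 1‖ₑ ^ 2 ∂ν)⁻¹ • ν.withDensity fun ζ => ‖(ζ : ℂ) - 1‖ₑ ^ 2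

section

variable {ν : Measure Circle}

theorem measurable_enorm_sub_one_sq : Measurable fun ζ : Circle => ‖(ζ : ℂ) - 1‖ₑ ^ 2 :=
  (continuous_circle_coe.sub continuous_const).enorm.measurable.pow_const 2

theorem enorm_sub_one_sq_eq (ζ : Circle) :
    ‖(ζ : ℂ) - 1‖ₑ ^ 2 = ENNReal.ofReal (Complex.normSq ((ζ : ℂ) - 1)) := by
  rw [← ofReal_norm, ← ENNReal.ofReal_pow (norm_nonneg _), Complex.normSq_eq_norm_sq]

theorem lintegral_enorm_sub_one_sq_ne_top [IsFiniteMeasure ν] :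
    ∫⁻ ζ : Circle, ‖(ζ : ℂ) - 1‖ₑ ^ 2 ∂ν ≠ ⊤ := by
  simp only [enorm_sub_one_sq_eq]
  have hc : Continuous fun ζ : Circle => Complex.normSq ((ζ : ℂ) - 1) :=
    Complex.continuous_normSq.comp (continuous_circle_coe.sub continuous_const)
  exact (hc.integrable_of_hasCompactSupport
    (HasCompactSupport.of_compactSpace _)).lintegral_lt_top.ne

theorem lintegral_enorm_sub_one_sq_ne_zero (hν : IsNontrivialMeasure ν) :
    ∫⁻ ζ : Circle, ‖(ζ : ℂ) - 1‖ₑ ^ 2 ∂ν ≠ 0 := by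
  intro h
  rw [lintegral_eq_zero_iff measurable_enorm_sub_one_sq] at h
  refine X_sub_C_ne_zero (1 : ℂ) (hν.eq_zero ?_)
  filter_upwards [h] with z hz
  simpa using hz

theorem isProbabilityMeasure_christoffelTransform [IsFiniteMeasure ν]
    (hν : IsNontrivialMeasure ν) : IsProbabilityMeasure (christoffelTransform ν) := by
  constructor
  rw [christoffelTransform, Measure.smul_apply, withDensity_apply _ MeasurableSet.univ,
    Measure.restrict_univ, smul_eq_mul]
  exact ENNReal.inv_mul_cancel (lintegral_enorm_sub_one_sq_ne_zero hν)
    lintegral_enorm_sub_one_sq_ne_top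

theorem lintegral_christoffelTransform_lt_top [IsFiniteMeasure ν] (hν : IsNontrivialMeasure ν) :
    ∫⁻ ζ : Circle, (‖(ζ : ℂ) - 1‖ₑ ^ 2)⁻¹ ∂(christoffelTransform ν) < ⊤ := by
  have hm : Measurable fun ζ : Circle => (‖(ζ : ℂ) - 1‖ₑ ^ 2)⁻¹ := measurable_enorm_sub_one_sq.inv
  rw [christoffelTransform, lintegral_smul_measure,
    lintegral_withDensity_eq_lintegral_mul _ measurable_enorm_sub_one_sq hm]
  refine ENNReal.mul_lt_top
    (ENNReal.inv_lt_top.2 (pos_iff_ne_zero.2 (lintegral_enorm_sub_one_sq_ne_zero hν))) ?_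
  -- At `ζ = 1` the product is `0 * ⊤ = 0`, so the bound by `1` holds there too.
  refine lt_of_le_of_lt (lintegral_mono (g := fun _ => 1) fun ζ => ENNReal.mul_inv_le_one _) ?_
  simp

theorem circleInner_christoffelTransform (p q : ℂ[X]) :
    circleInner (christoffelTransform ν) p q =
      ((∫⁻ ζ : Circle, ‖(ζ : ℂ) - 1‖ₑ ^ 2 ∂ν)⁻¹).toReal •
        circleInner ν ((X - 1) * p) ((X - 1) * q) := by
  rw [christoffelTransform, circleInner, integral_smul_measure,
    integral_withDensity_eq_integral_toReal_smul measurable_enorm_sub_one_sq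
      (Filter.Eventually.of_forall fun ζ => by
        rw [enorm_sub_one_sq_eq]; exact ENNReal.ofReal_lt_top), circleInner]
  congr 1
  refine integral_congr_ae (Filter.Eventually.of_forall fun ζ => ?_)
  simp only [enorm_sub_one_sq_eq, ENNReal.toReal_ofReal (Complex.normSq_nonneg _),
    Complex.real_smul, Complex.normSq_eq_conj_mul_self, eval_mul, eval_sub, eval_X, eval_one,
    map_mul]
  ring

/-- On the circle `conj (z - 1) = -conj z * (z - 1)`. This moves both factors to the right-hand
polynomial, where `(X-1)^2 Φ n` has a known expansion. -/
theorem circleInner_X_sub_one_mul (p q : ℂ[X]) :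
    circleInner ν ((X - 1) * p) ((X - 1) * q) = -circleInner ν (X * p) ((X - 1) ^ 2 * q) := by
  rw [circleInner, circleInner, ← integral_neg]
  refine integral_congr_ae (Filter.Eventually.of_forall fun z => ?_)
  simp only [eval_mul, eval_pow, eval_sub, eval_X, eval_one, map_mul, map_sub, map_one]
  linear_combination ((starRingEnd ℂ) (p.eval (z : ℂ)) * q.eval (z : ℂ) * (z - 1)) *
    circle_mul_conj z

/-- The orthogonal polynomials of the Christoffel transform. -/
theorem isMonicOPUC_christoffelTransform [IsFiniteMeasure ν] {β : ℕ → ℂ}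
    (hβ : IsMonicOPUC ν (szegoPoly β)) {Φ : ℕ → ℂ[X]}
    (hmonic : ∀ n, (Φ n).Monic ∧ (Φ n).natDegree = n) {a b : ℕ → ℂ}
    (hΦ : ∀ n, (X - 1) ^ 2 * Φ n = X * szegoPoly β (n + 1) + C (a n) * szegoPoly β (n + 1)
      + C (b n) * szegoRev β (n + 1)) :
    IsMonicOPUC (christoffelTransform ν) Φ := by
  have horth : ∀ (n : ℕ) (p : ℂ[X]), p.degree < n →
      circleInner ν p (szegoPoly β n) = 0 := fun n p hp => hβ.circleInner_eq_zero hp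
  have key : ∀ m n, m < n → circleInner (christoffelTransform ν) (Φ m) (Φ n) = 0 := by
    intro m n hmn
    have hd : (Φ m).degree = m := by
      rw [degree_eq_natDegree (hmonic m).1.ne_zero, (hmonic m).2]
    -- For `m < n`, `X * Φ m` is a multiple of `X` of degree at most `n`, hence orthogonal to all
    -- three terms of the expansion.
    have h1 : (Φ m).degree < ((n + 1 : ℕ) : WithBot ℕ) := by rw [hd]; exact_mod_cast (by omega)
    have h2 : (X * Φ m).degree < ((n + 1 : ℕ) : WithBot ℕ) := by
      rw [degree_mul, degree_X, hd]; exact_mod_cast (by omega)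
    have e1 : circleInner ν (X * Φ m) (X * szegoPoly β (n + 1)) = 0 := by
      rw [circleInner_X_mul]; exact horth _ _ h1
    have e2 := horth _ _ h2
    have e3 : circleInner ν (X * Φ m) (szegoRev β (n + 1)) = 0 :=
      circleInner_X_mul_szegoRev (horth _) h1
    rw [circleInner_christoffelTransform, circleInner_X_sub_one_mul, hΦ]
    rw [← circleForm_apply] at e1 e2 e3 ⊢
    rw [map_add, map_add, e1, ← smul_eq_C_mul, ← smul_eq_C_mul, map_smul, map_smul, e2, e3]
    simp
  refine ⟨hmonic, fun m n hmn => ?_⟩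
  rcases hmn.lt_or_gt with h | h
  · exact key m n h
  · rw [circleInner_symm, key n m h, map_zero]

end

/-! ### The recurrence on the real line and the Szegő recursion -/

theorem one_add_I_mul_ne_zero (r : ℝ) : (1 + Complex.I * r : ℂ) ≠ 0 := fun h => by
  simpa using congrArg Complex.re h

theorem one_sub_I_mul_ne_zero (r : ℝ) : (1 - Complex.I * r : ℂ) ≠ 0 := fun h => by
  simpa using congrArg Complex.re h

theorem ofReal_sub_I_ne_zero (x : ℝ) : (x : ℂ) - Complex.I ≠ 0 := fun h => by
  simpa using congrArg Complex.im h

section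

variable (c d g : ℕ → ℝ)

theorem tauSeq_eq_prod_div (n : ℕ) : tauSeq c n =
    (∏ j ∈ Finset.Icc 1 n, (1 - Complex.I * (c j : ℂ))) /
      ∏ j ∈ Finset.Icc 1 n, (1 + Complex.I * (c j : ℂ)) := by
  induction n with
  | zero => simp [tauSeq]
  | succ n ih =>
    rw [tauSeq, ih, Finset.prod_Icc_succ_top (by omega), Finset.prod_Icc_succ_top (by omega),
      div_mul_div_comm]

theorem prod_one_add_ne_zero (n : ℕ) : ∏ j ∈ Finset.Icc 1 n, (1 + Complex.I * (c j : ℂ)) ≠ 0 :=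
  Finset.prod_ne_zero_iff.2 fun _ _ => one_add_I_mul_ne_zero _

theorem prod_one_sub_ne_zero (n : ℕ) : ∏ j ∈ Finset.Icc 1 n, (1 - Complex.I * (c j : ℂ)) ≠ 0 :=
  Finset.prod_ne_zero_iff.2 fun _ _ => one_sub_I_mul_ne_zero _

theorem conj_prod_one_add (n : ℕ) :
    (starRingEnd ℂ) (∏ j ∈ Finset.Icc 1 n, (1 + Complex.I * (c j : ℂ))) =
      ∏ j ∈ Finset.Icc 1 n, (1 - Complex.I * (c j : ℂ)) := by
  simp [map_prod, sub_eq_add_neg]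

theorem conj_prod_one_sub (n : ℕ) :
    (starRingEnd ℂ) (∏ j ∈ Finset.Icc 1 n, (1 - Complex.I * (c j : ℂ))) =
      ∏ j ∈ Finset.Icc 1 n, (1 + Complex.I * (c j : ℂ)) := by
  simp [map_prod, sub_eq_add_neg]

theorem norm_tauSeq (n : ℕ) : ‖tauSeq c n‖ = 1 := by
  rw [tauSeq_eq_prod_div, norm_div, ← conj_prod_one_add, RCLike.norm_conj, div_self]
  exact norm_ne_zero_iff.2 (prod_one_add_ne_zero c n)

/-- The coefficients of the Szegő recursion attached to a parameter sequence `g`. -/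
def paramCoeff (n : ℕ) : ℂ :=
  (1 / tauSeq c n) *
    ((1 - 2 * g (n + 1) - Complex.I * c (n + 1)) / (1 - Complex.I * c (n + 1)))

theorem alphaSeq_eq_neg_paramCoeff (n : ℕ) :
    alphaSeq c d n = -paramCoeff c (minParam d) (n + 1) := by
  rw [alphaSeq, paramCoeff, neg_mul]

theorem paramCoeff_eq (n : ℕ) : paramCoeff c g n =
    (∏ j ∈ Finset.Icc 1 n, (1 + Complex.I * (c j : ℂ))) /
      (∏ j ∈ Finset.Icc 1 n, (1 - Complex.I * (c j : ℂ))) *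
    ((1 - 2 * g (n + 1) - Complex.I * c (n + 1)) / (1 - Complex.I * c (n + 1))) := by
  rw [paramCoeff, tauSeq_eq_prod_div, one_div_div]

theorem conj_paramCoeff (n : ℕ) : (starRingEnd ℂ) (paramCoeff c g n) =
    (∏ j ∈ Finset.Icc 1 n, (1 - Complex.I * (c j : ℂ))) /
      (∏ j ∈ Finset.Icc 1 n, (1 + Complex.I * (c j : ℂ))) *
    ((1 - 2 * g (n + 1) + Complex.I * c (n + 1)) / (1 + Complex.I * c (n + 1))) := by
  rw [paramCoeff_eq]
  simp only [map_mul, map_div₀, conj_prod_one_add, conj_prod_one_sub]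
  simp [sub_eq_add_neg, map_ofNat]

/-- `tauSeq` is unimodular and `1 - (1 - 2g)^2 = 4g(1 - g)`. This gives both the bound by `1` and
the norms. -/
theorem one_sub_norm_paramCoeff_sq (n : ℕ) : 1 - ‖paramCoeff c g n‖ ^ 2 =
    4 * g (n + 1) * (1 - g (n + 1)) / (1 + c (n + 1) ^ 2) := by
  have h1 : ‖(1 - 2 * g (n + 1) - Complex.I * c (n + 1) : ℂ)‖ ^ 2 =
      (1 - 2 * g (n + 1)) ^ 2 + c (n + 1) ^ 2 := by
    rw [← Complex.normSq_eq_norm_sq, Complex.normSq_apply]; simp; ring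
  have h2 : ‖(1 - Complex.I * c (n + 1) : ℂ)‖ ^ 2 = 1 + c (n + 1) ^ 2 := by
    rw [← Complex.normSq_eq_norm_sq, Complex.normSq_apply]; simp; ring
  have h3 : 1 + c (n + 1) ^ 2 ≠ 0 := by positivity
  rw [paramCoeff, norm_mul, norm_div, norm_div, norm_tauSeq, norm_one, div_one, one_mul, div_pow,
    h1, h2]
  field_simp
  ring

theorem norm_paramCoeff_lt_one {n : ℕ} (h0 : 0 < g (n + 1)) (h1 : g (n + 1) < 1) :
    ‖paramCoeff c g n‖ < 1 := by
  have h := one_sub_norm_paramCoeff_sq c g n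
  have : 0 < 4 * g (n + 1) * (1 - g (n + 1)) / (1 + c (n + 1) ^ 2) := by
    have : 0 < 1 - g (n + 1) := by linarith
    positivity
  rw [← h] at this
  nlinarith [norm_nonneg (paramCoeff c g n)]

/-- `P (n + 1) - (1 - g (n + 1)) * w * P n` at the point `x`. -/
def paramComb (x : ℝ) (w : ℂ) (n : ℕ) : ℂ :=
  ((rTwoPoly c d (n + 1)).eval x : ℝ) - (1 - (g (n + 1) : ℂ)) * w * ((rTwoPoly c d n).eval x : ℝ)

variable {d g} in
-- The Szegő step before normalization: the chain relation splits `d`, and `x^2 + 1 = (x-i)(x+i)`,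
-- so the two combinations at `x - i` and `x + i` close up under the recurrence.
theorem two_mul_paramComb_sub_I {n : ℕ} (h : (1 - g (n + 1)) * g (n + 2) = d (n + 2)) (x : ℝ) :
    2 * paramComb c d g x (x - Complex.I) (n + 1) =
      (1 + Complex.I * c (n + 2)) * (x + Complex.I) * paramComb c d g x (x - Complex.I) n
      - (1 - 2 * g (n + 2) + Complex.I * c (n + 2)) * (x - Complex.I) *
        paramComb c d g x (x + Complex.I) n := by
  simp only [paramComb, rTwoPoly, ← h, eval_sub, eval_mul, eval_add, eval_pow, eval_X, eval_C,
    eval_one]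
  push_cast
  linear_combination (-2 * (1 - (g (n + 1) : ℂ)) * g (n + 2) * (eval x (rTwoPoly c d n) : ℝ)
    - 2 * c (n + 2) * (eval x (rTwoPoly c d (n + 1)) : ℝ)) * Complex.I_sq

variable {d g} in
-- All data being real, this is the complex conjugate of `two_mul_paramComb_sub_I`.
theorem two_mul_paramComb_add_I {n : ℕ} (h : (1 - g (n + 1)) * g (n + 2) = d (n + 2)) (x : ℝ) :
    2 * paramComb c d g x (x + Complex.I) (n + 1) =
      (1 - Complex.I * c (n + 2)) * (x - Complex.I) * paramComb c d g x (x + Complex.I) n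
      - (1 - 2 * g (n + 2) - Complex.I * c (n + 2)) * (x + Complex.I) *
        paramComb c d g x (x - Complex.I) n := by
  have := congrArg (starRingEnd ℂ) (two_mul_paramComb_sub_I c h x)
  simpa [paramComb, sub_eq_add_neg, map_ofNat] using this

/-- The polynomials of the Szegő recursion with coefficients `paramCoeff c g`, on the circle. -/
theorem szego_paramCoeff_eval (hg : ∀ n, (1 - g (n + 1)) * g (n + 2) = d (n + 2)) (n : ℕ) (x : ℝ) :
    (szegoPoly (paramCoeff c g) (n + 1)).eval (((x : ℂ) + Complex.I) / ((x : ℂ) - Complex.I)) =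
      2 ^ (n + 1) / (∏ j ∈ Finset.Icc 1 (n + 1), (1 + Complex.I * (c j : ℂ))) /
        ((x : ℂ) - Complex.I) ^ (n + 1) * paramComb c d g x (x - Complex.I) n ∧
    (szegoRev (paramCoeff c g) (n + 1)).eval (((x : ℂ) + Complex.I) / ((x : ℂ) - Complex.I)) =
      2 ^ (n + 1) / (∏ j ∈ Finset.Icc 1 (n + 1), (1 - Complex.I * (c j : ℂ))) /
        ((x : ℂ) - Complex.I) ^ (n + 1) * paramComb c d g x (x + Complex.I) n := by
  have hw := ofReal_sub_I_ne_zero x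
  induction n with
  | zero =>
    have hc := one_add_I_mul_ne_zero (c 1)
    have hc' := one_sub_I_mul_ne_zero (c 1)
    rw [szegoPoly_succ, szegoRev_succ, conj_paramCoeff, paramCoeff_eq]
    simp only [zero_add, Finset.Icc_self, Finset.prod_singleton, paramComb, rTwoPoly,
      szegoPoly_zero, szegoRev_zero, eval_sub, eval_mul, eval_X, eval_C, eval_one, pow_one,
      Finset.Icc_eq_empty_of_lt zero_lt_one, Finset.prod_empty]
    push_cast
    constructor
    · field_simp
      linear_combination (2 * c 1 : ℂ) * Complex.I_sq
    · field_simp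
      linear_combination (2 * c 1 : ℂ) * Complex.I_sq
  | succ n ih =>
    obtain ⟨ih1, ih2⟩ := ih
    have hc := one_add_I_mul_ne_zero (c (n + 2))
    have hc' := one_sub_I_mul_ne_zero (c (n + 2))
    have hC := prod_one_add_ne_zero c (n + 1)
    have hD := prod_one_sub_ne_zero c (n + 1)
    have e1 := two_mul_paramComb_sub_I c (hg n) x
    have e2 := two_mul_paramComb_add_I c (hg n) x
    rw [szegoPoly_succ _ (n + 1), szegoRev_succ _ (n + 1), conj_paramCoeff, paramCoeff_eq,
      Finset.prod_Icc_succ_top (by omega : 1 ≤ n + 1 + 1),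
      Finset.prod_Icc_succ_top (by omega : 1 ≤ n + 1 + 1)]
    simp only [eval_sub, eval_mul, eval_X, eval_C, ih1, ih2]
    generalize paramComb c d g x (x - Complex.I) (n + 1) = S' at e1 e2 ⊢
    generalize paramComb c d g x (x + Complex.I) (n + 1) = T' at e1 e2 ⊢
    generalize paramComb c d g x (x - Complex.I) n = S at e1 e2 ⊢
    generalize paramComb c d g x (x + Complex.I) n = T at e1 e2 ⊢
    generalize (∏ j ∈ Finset.Icc 1 (n + 1), (1 + Complex.I * (c j : ℂ))) = K at hC ⊢
    generalize (∏ j ∈ Finset.Icc 1 (n + 1), (1 - Complex.I * (c j : ℂ))) = K' at hD ⊢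
    generalize (x : ℂ) - Complex.I = w at hw e1 e2 ⊢
    generalize (x : ℂ) + Complex.I = w' at e1 e2 ⊢
    rw [mul_comm 2, ← eq_div_iff two_ne_zero] at e1 e2
    subst e1 e2
    constructor
    · field_simp
      ring
    · field_simp
      ring

end

/-- Polynomials that agree at all points `(x + i) / (x - i)`, `x` real, are equal. -/
theorem Polynomial.eq_of_eval_cayley {p q : ℂ[X]}
    (h : ∀ x : ℝ, p.eval (((x : ℂ) + Complex.I) / ((x : ℂ) - Complex.I)) =
      q.eval (((x : ℂ) + Complex.I) / ((x : ℂ) - Complex.I))) : p = q := by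
  refine eq_of_infinite_eval_eq p q (Set.infinite_of_injective_forall_mem
    (f := fun x : ℝ => ((x : ℂ) + Complex.I) / ((x : ℂ) - Complex.I)) (fun x y hxy => ?_) h)
  simp only at hxy
  rw [div_eq_div_iff (ofReal_sub_I_ne_zero x) (ofReal_sub_I_ne_zero y)] at hxy
  have h2 : (2 * Complex.I) * ((x : ℂ) - y) = 0 := by linear_combination -hxy
  rcases mul_eq_zero.1 h2 with h3 | h3
  · simp at h3
  · exact_mod_cast sub_eq_zero.1 h3

/-- Recursions that start with the coefficient `1` are multiples of `X - 1`. -/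
theorem szego_succ_eq_X_sub_one_mul {α β : ℕ → ℂ} (h0 : β 0 = 1) (h : ∀ n, β (n + 1) = -α n)
    (n : ℕ) : szegoPoly β (n + 1) = (X - 1) * szegoPoly α n ∧
      szegoRev β (n + 1) = (1 - X) * szegoRev α n := by
  -- The reversed polynomial acquires `1 - X` rather than `X - 1`; this is the source of the sign in
  -- `β (n+1) = -α n`.
  induction n with
  | zero => simp [szegoPoly_succ, szegoRev_succ, h0]
  | succ n ih =>
    rw [szegoPoly_succ β (n + 1), szegoRev_succ β (n + 1), ih.1, ih.2, h n, szegoPoly_succ α, szegoRev_succ α]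
    simp only [map_neg]
    constructor <;> ring

/-- A chain sequence with more than one parameter sequence has one that starts positive. -/
theorem HasMultipleParameterSequences.exists_pos {d : ℕ → ℝ}
    (h : HasMultipleParameterSequences d) : ∃ g, IsParameterSequence d g ∧ 0 < g 1 := by
  obtain ⟨g, k, hg, hk, n, hn, hne⟩ := h
  by_contra! hall
  have hg1 : g 1 = 0 := le_antisymm (hall g hg) hg.1.1
  have hk1 : k 1 = 0 := le_antisymm (hall k hk) hk.1.1
  refine hne ?_
  induction n, hn using Nat.le_induction with
  | base => rw [hg1, hk1]
  | succ n hn ih =>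
    -- The induction carries `hne` along, so `ih` assumes `g n ≠ k n`. In the equal case, `k n < 1`
    -- lets the chain relation determine the next parameter.
    by_cases e : g n = k n
    · have hlt : 0 < 1 - k n := by
        rcases Nat.eq_or_lt_of_le hn with rfl | h2
        · linarith [hk.1.2]
        · linarith [(hk.2.1 n h2).2]
      have e1 := hg.2.2 n hn
      rw [e, ← hk.2.2 n hn] at e1
      exact mul_left_cancel₀ hlt.ne' e1
    · exact absurd (ih e) e

/-! ### The minimal parameter sequence: explicit formula, norms, and comparison with other parameter
sequences -/

section

variable {c d g : ℕ → ℝ}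

theorem IsParameterSequence.mul_succ (hg : IsParameterSequence d g) (n : ℕ) :
    (1 - g (n + 1)) * g (n + 2) = d (n + 2) := hg.2.2 (n + 1) (by omega)

theorem IsParameterSequence.lt_one (hg : IsParameterSequence d g) (n : ℕ) : g (n + 1) < 1 := by
  cases n with
  | zero => exact hg.1.2
  | succ n => exact (hg.2.1 (n + 2) (by omega)).2

theorem szego_paramCoeff_minParam (c d : ℕ → ℝ) (n : ℕ) :
    szegoPoly (paramCoeff c (minParam d)) (n + 1) = (X - 1) * szegoPoly (alphaSeq c d) n :=
  (szego_succ_eq_X_sub_one_mul (by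
    simp only [paramCoeff, tauSeq, zero_add, minParam]
    simp [div_self (one_sub_I_mul_ne_zero (c 1))])
    (fun n => by rw [alphaSeq_eq_neg_paramCoeff, neg_neg]) n).1

theorem isGivenByRTwo_szegoPoly (c : ℕ → ℝ) (hd : IsPositiveChainSequence d) :
    IsGivenByRTwo c d (szegoPoly (alphaSeq c d)) := by
  intro n x
  have hw := ofReal_sub_I_ne_zero x
  have hC := prod_one_add_ne_zero c (n + 1)
  have h := (szego_paramCoeff_eval c d (minParam d)
    (minParam_isParameterSequence hd).mul_succ n x).1
  have hI : ((x : ℂ) + Complex.I) / ((x : ℂ) - Complex.I) - 1 =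
      2 * Complex.I / ((x : ℂ) - Complex.I) := by field_simp; ring
  rw [szego_paramCoeff_minParam, eval_mul, eval_sub, eval_X, eval_one, hI, paramComb] at h
  generalize (((rTwoPoly c d (n + 1)).eval x : ℝ) : ℂ) - (1 - (minParam d (n + 1) : ℂ)) *
    ((x : ℂ) - Complex.I) * ((rTwoPoly c d n).eval x : ℝ) = S at h ⊢
  generalize (∏ j ∈ Finset.Icc 1 (n + 1), (1 + Complex.I * (c j : ℂ))) = K at hC h ⊢
  generalize eval (((x : ℂ) + Complex.I) / ((x : ℂ) - Complex.I)) (szegoPoly (alphaSeq c d) n) = E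
    at h ⊢
  generalize (x : ℂ) - Complex.I = w at hw h ⊢
  -- The factor `w * (-i) / 2` is the inverse of `ζ - 1 = 2i/w`.
  have hE : E = w * (-Complex.I) / 2 * (2 * Complex.I / w * E) := by
    field_simp
    linear_combination E * Complex.I_sq
  rw [hE, h]
  rw [pow_succ, pow_succ]
  field_simp

theorem norm_alphaSeq_lt_one (c : ℕ → ℝ) (hd : IsPositiveChainSequence d) (n : ℕ) :
    ‖alphaSeq c d n‖ < 1 := by
  have h := (minParam_isParameterSequence hd).2.1 (n + 2) (by omega)
  rw [alphaSeq_eq_neg_paramCoeff, norm_neg]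
  exact norm_paramCoeff_lt_one c _ h.1 h.2

/-- By the chain relation the factor `4 ℓ (1 - ℓ) / (1 + c^2)` at index `k+2` equals `4 d (k+3) / (1
+ c^2)` times `ℓ (k+2) / ℓ (k+3)`, and these quotients telescope. The start uses `d 2 = ℓ 2`; the
factor `1 + c 1 ^ 2` cancels the `j = 1` term. -/
theorem szegoNormSq_alphaSeq (c : ℕ → ℝ) (hd : IsPositiveChainSequence d) (k : ℕ) :
    szegoNormSq (alphaSeq c d) k =
      ((1 + c 1 ^ 2) * 2 ^ (2 * k) * ∏ j ∈ Finset.Icc 1 (k + 1), d (j + 1)) /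
        (minParam d (k + 2) * ∏ j ∈ Finset.Icc 1 (k + 1), (1 + c j ^ 2)) := by
  have hℓ := minParam_isParameterSequence hd
  have hpos : ∀ n, minParam d (n + 2) ≠ 0 := fun n => (hℓ.2.1 (n + 2) (by omega)).1.ne'
  have hc : ∀ j, 1 + c j ^ 2 ≠ 0 := fun j => by positivity
  induction k with
  | zero =>
    have h := hℓ.mul_succ 0
    simp only [zero_add, show minParam d 1 = 0 from rfl, sub_zero, one_mul] at h
    have := hpos 0
    have := hc 1
    simp only [szegoNormSq_zero, zero_add, Finset.Icc_self, Finset.prod_singleton, mul_zero,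
      pow_zero, mul_one, one_add_one_eq_two, ← h]
    field_simp
  | succ k ih =>
    have h1 := hpos k
    have h2 := hpos (k + 1)
    have h3 := hc (k + 1 + 1)
    have h4 : ∏ j ∈ Finset.Icc 1 (k + 1), (1 + c j ^ 2) ≠ 0 :=
      Finset.prod_ne_zero_iff.2 fun j _ => hc j
    rw [szegoNormSq_succ, ih, alphaSeq_eq_neg_paramCoeff, norm_neg, one_sub_norm_paramCoeff_sq,
      Finset.prod_Icc_succ_top (by omega : 1 ≤ k + 1 + 1),
      Finset.prod_Icc_succ_top (by omega : 1 ≤ k + 1 + 1), ← hℓ.mul_succ (k + 1)]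
    field_simp
    ring

/-- The polynomials attached to the minimal parameter sequence in terms of those attached to any
other parameter sequence. -/
theorem X_sub_one_sq_mul_szegoPoly_alphaSeq (c : ℕ → ℝ) (hg : IsParameterSequence d g) (n : ℕ) :
    (X - 1) ^ 2 * szegoPoly (alphaSeq c d) n =
      X * szegoPoly (paramCoeff c g) (n + 1)
      + C ((minParam d (n + 1) - g (n + 1) : ℂ) / (1 - g (n + 1)) - 1) *
        szegoPoly (paramCoeff c g) (n + 1)
      + C (-((minParam d (n + 1) - g (n + 1) : ℂ) / (1 - g (n + 1)) * tauSeq c (n + 1))) *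
        szegoRev (paramCoeff c g) (n + 1) := by
  -- Replacing `g` by `ℓ` adds `(ℓ - g)(x - i) P n` to the combination. After multiplication by `ζ -
  -- 1` this is `(ℓ - g)/(1 - g)` times the difference of the `g`-combinations at `x - i` and `x +
  -- i`; `tauSeq` reconciles their normalizations.
  refine Polynomial.eq_of_eval_cayley fun x => ?_
  have hw := ofReal_sub_I_ne_zero x
  have hC := prod_one_add_ne_zero c (n + 1)
  have hD := prod_one_sub_ne_zero c (n + 1)
  have hlt : (1 - g (n + 1) : ℂ) ≠ 0 := by
    exact_mod_cast (sub_pos.2 (hg.lt_one n)).ne'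
  obtain ⟨h1, h2⟩ := szego_paramCoeff_eval c d g hg.mul_succ n x
  have h3 := (szego_paramCoeff_eval c d (minParam d)
    (minParam_isParameterSequence ⟨g, hg⟩).mul_succ n x).1
  rw [sq, mul_assoc, ← szego_paramCoeff_minParam]
  simp only [eval_add, eval_mul, eval_sub, eval_X, eval_one, eval_C, h1, h2, h3, paramComb,
    tauSeq_eq_prod_div]
  generalize (∏ j ∈ Finset.Icc 1 (n + 1), (1 + Complex.I * (c j : ℂ))) = K at hC ⊢
  generalize (∏ j ∈ Finset.Icc 1 (n + 1), (1 - Complex.I * (c j : ℂ))) = K' at hD ⊢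
  generalize (x : ℂ) - Complex.I = w at hw ⊢
  generalize (x : ℂ) + Complex.I = w'
  field_simp
  ring

/-- A parameter sequence with `g 1 > 0` keeps the initial coefficient off the unit circle, so it has
a measure `ν`. The Christoffel transform of `ν` shares its orthogonal polynomials with `μ`, hence
equals `μ`. -/
theorem lintegral_lt_top_of_hasMultipleParameterSequences {μ : Measure Circle}
    [IsProbabilityMeasure μ] (hμ : IsMonicOPUC μ (szegoPoly (alphaSeq c d)))
    (h : HasMultipleParameterSequences d) :
    ∫⁻ ζ : Circle, (‖(ζ : ℂ) - 1‖ₑ ^ 2)⁻¹ ∂μ < ⊤ := by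
  obtain ⟨g, hg, hg1⟩ := h.exists_pos
  have hβ : ∀ n, ‖paramCoeff c g n‖ < 1 := fun n =>
    norm_paramCoeff_lt_one c g (by
      cases n with
      | zero => exact hg1
      | succ n => exact (hg.2.1 (n + 2) (by omega)).1) (hg.lt_one n)
  obtain ⟨ν, hν, e⟩ := exists_circleInner_eq_szegoForm hβ
  have hνn := isNontrivialMeasure_of_szegoForm hβ e
  have hp := isProbabilityMeasure_christoffelTransform hνn
  rw [hμ.measure_unique (isMonicOPUC_christoffelTransform (isMonicOPUC_szegoPoly e)
    hμ.1 (X_sub_one_sq_mul_szegoPoly_alphaSeq c hg))]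
  exact lintegral_christoffelTransform_lt_top hνn

end

end

theorem theorem3p2 (c d : ℕ → ℝ) (hd : IsPositiveChainSequence d) :
    (∃! Φ : ℕ → ℂ[X], IsGivenByRTwo c d Φ) ∧
    (∃! μ : Measure Circle,
      IsProbabilityMeasure μ ∧ HasVerblunskyCoefficients μ (alphaSeq c d)) ∧
    ∀ (Φ : ℕ → ℂ[X]) (μ : Measure Circle), IsGivenByRTwo c d Φ →
      IsProbabilityMeasure μ → HasVerblunskyCoefficients μ (alphaSeq c d) →
      IsMonicOPUC μ Φ ∧
      (∀ m k : ℕ, circleInner μ (Φ m) (Φ k) =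
        if m = k then
          ((((1 + c 1 ^ 2) * 2 ^ (2 * k) * ∏ j ∈ Finset.Icc 1 (k + 1), d (j + 1)) /
            (minParam d (k + 2) * ∏ j ∈ Finset.Icc 1 (k + 1), (1 + c j ^ 2)) : ℝ) : ℂ)
        else 0) ∧
      (HasMultipleParameterSequences d →
        ∫⁻ ζ : Circle, (‖(ζ : ℂ) - 1‖ₑ ^ 2)⁻¹ ∂μ < ⊤) := by
  have hα := norm_alphaSeq_lt_one c hd
  have hgiven := isGivenByRTwo_szegoPoly c hd
  have huniq : ∀ Φ, IsGivenByRTwo c d Φ → Φ = szegoPoly (alphaSeq c d) := fun Φ hΦ =>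
    funext fun n => Polynomial.eq_of_eval_cayley fun x => (hΦ n x).trans (hgiven n x).symm
  refine ⟨⟨_, hgiven, huniq⟩, existsUnique_hasVerblunskyCoefficients hα, ?_⟩
  intro Φ μ hΦ _ hμ
  obtain rfl := huniq Φ hΦ
  refine ⟨hμ.isMonicOPUC, fun m k => ?_,
    lintegral_lt_top_of_hasMultipleParameterSequences hμ.isMonicOPUC⟩
  rw [hμ.circleInner_eq hα, szegoForm_szegoPoly, szegoNormSq_alphaSeq c hd]
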